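/- Let $d\ge 1$, let $\lambda$ be Lebesgue measure on $\mathbb R^d$, let $\|\cdot\|$ be the Euclidean norm, and let $B_{x,r}$ be the closed ball of radius $r$ centered at $x\in\mathbb R^d$. For $k\ge 1$ put $$W_k=\frac{\lambda\left(B_{e_1,1}\cup B_{Y_1,\|Y_1\|}\cup\dots\cup B_{Y_{k-1},\|Y_{k-1}\|}\right)}{\lambda(B_{0,1})},$$ where $e_1=(1,0,\dots,0)$ and $Y_1,\dots,Y_{k-1}$ are independent and uniformly distributed in $B_{0,1}$. There is a non-negative random variable $Z$ with $$\mathbb E[Z^k]=\mathbb E\left[\frac{k!}{W_k^k}\right]\qquad\text{for all } k\ge 1,$$ and its distribution is the only probability distribution on $\mathbb R$ with these moments; it depends only on $d$. Let $\mu$ be any probability measure on $\mathbb R^d$ that has a density $f$ with respect to $\lambda$, let $X_1,X_2,\dots$ be independent random vectors with distribution $\mu$, and let $$S_1=S_1^{(n)}=\left\{z\in\mathbb R^d:\ \|z-X_1\|=\min_{1\le j\le n}\|z-X_j\|\right\}$$ be the Voronoi cell of $X_1$ among $X_1,\dots,X_n$. Then, for $\mu$-almost every $x$, the conditional distribution of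 the random variable $n\,\mu(S_1^{(n)})$ given $X_1=x$ converges weakly, as $n\to\infty$, to the distribution of $Z$. -/

import Mathlib

open MeasureTheory ProbabilityTheory Filter Topology
open scoped Nat

noncomputable section

/-- The Voronoi cell of the `i`-th of the points `p 0, …, p (n - 1)` of `ℝ^d` (Euclidean norm):
the points whose nearest neighbour among them is `p i`, ties being broken in favour of smaller
indices. -/
def voronoiCell {d n : ℕ} (p : Fin n → EuclideanSpace ℝ (Fin d)) (i : Fin n) :
    Set (EuclideanSpace ℝ (Fin d)) :=
  {z | (∀ j, ‖z - p i‖ ≤ ‖z - p j‖) ∧ ∀ j < i, ‖z - p i‖ < ‖z - p j‖}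

/-- The random variable `n μ(S₁)`, as a function of the sample points `p 0, …, p (n - 1)`. -/
def scaledFirstCellMass {d : ℕ} (μ : Measure (EuclideanSpace ℝ (Fin d))) (n : ℕ) [NeZero n]
    (p : Fin n → EuclideanSpace ℝ (Fin d)) : ℝ :=
  (n : ℝ) * μ.real (voronoiCell p 0)

/-- The uniform distribution on the closed unit ball of `ℝ^d`. -/
def uniformUnitBall (d : ℕ) : Measure (EuclideanSpace ℝ (Fin d)) :=
  ProbabilityTheory.cond volume (Metric.closedBall 0 1)

/-- The volume of the union of the closed ball of radius `1` about `(1, 0, …, 0)` and of the `m`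
closed balls of radius `‖y i‖` about `y i`, divided by the volume of the unit ball. -/
def unionVolumeRatio {d m : ℕ} [NeZero d] (y : Fin m → EuclideanSpace ℝ (Fin d)) : ℝ :=
  volume.real (Metric.closedBall (EuclideanSpace.single (0 : Fin d) (1 : ℝ)) 1 ∪
      ⋃ i, Metric.closedBall (y i) ‖y i‖) /
    volume.real (Metric.closedBall (0 : EuclideanSpace ℝ (Fin d)) 1)

/-- `E[k! / W_k ^ k]`, where `W_k = unionVolumeRatio (Y_1, …, Y_{k-1})` for independent
`Y_1, …, Y_{k-1}` uniformly distributed on the unit ball. -/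
def limitMoment (d : ℕ) [NeZero d] (k : ℕ) : ℝ :=
  ∫ y : Fin (k - 1) → EuclideanSpace ℝ (Fin d), (k ! : ℝ) / unionVolumeRatio y ^ k
    ∂(Measure.pi fun _ => uniformUnitBall d)

/-- For every `k ≥ 1`, the `k`-th moment of the probability measure `ν` exists and is equal to
`limitMoment d k`. -/
def HasLimitMoments (d : ℕ) [NeZero d] (ν : ProbabilityMeasure ℝ) : Prop :=
  ∀ k : ℕ, 1 ≤ k → Integrable (fun z : ℝ => z ^ k) (ν : Measure ℝ) ∧
    ∫ z, z ^ k ∂(ν : Measure ℝ) = limitMoment d k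

/-- `n μ(S₁)` is a measurable function of the sample, so that its conditional distributions are
the genuine ones. -/
theorem measurable_scaledFirstCellMass {d : ℕ} (μ : Measure (EuclideanSpace ℝ (Fin d)))
    [SFinite μ] (n : ℕ) [NeZero n] : Measurable (scaledFirstCellMass μ n) := by
  have h : MeasurableSet {q : (Fin n → EuclideanSpace ℝ (Fin d)) × EuclideanSpace ℝ (Fin d) |
      (∀ j, ‖q.2 - q.1 0‖ ≤ ‖q.2 - q.1 j‖) ∧ ∀ j < 0, ‖q.2 - q.1 0‖ < ‖q.2 - q.1 j‖} := by
    rw [Set.ofPred_and, Set.ofPred_forall, Set.ofPred_forall]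
    refine MeasurableSet.inter (MeasurableSet.iInter fun j => ?_) (MeasurableSet.iInter fun j => ?_)
    · exact measurableSet_le (by fun_prop) (by fun_prop)
    · rw [Set.ofPred_forall]
      exact MeasurableSet.iInter fun _ => measurableSet_lt (by fun_prop) (by fun_prop)
  exact (measurable_measure_prodMk_left h).ennreal_toReal.const_mul _

instance isProbabilityMeasure_uniformUnitBall (d : ℕ) :
    IsProbabilityMeasure (uniformUnitBall d) :=
  cond_isProbabilityMeasure_of_finite (Metric.measure_closedBall_pos _ _ one_pos).ne'
    (isCompact_closedBall _ _).measure_lt_top.ne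

/-- The normalized volume is at least `1`. -/
theorem one_le_unionVolumeRatio {d m : ℕ} [NeZero d] (y : Fin m → EuclideanSpace ℝ (Fin d)) :
    1 ≤ unionVolumeRatio y := by
  have h0 : volume (⋃ i, Metric.closedBall (y i) ‖y i‖) ≠ ⊤ := by
    refine (isCompact_iUnion fun i => isCompact_closedBall _ _).measure_lt_top.ne
  have hp : 0 < volume.real (Metric.closedBall (0 : EuclideanSpace ℝ (Fin d)) 1) :=
    ENNReal.toReal_pos (Metric.measure_closedBall_pos _ _ one_pos).ne'
      (isCompact_closedBall _ _).measure_lt_top.ne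
  rw [unionVolumeRatio, one_le_div hp, measureReal_def,
    ← Measure.addHaar_closedBall_center volume
      (EuclideanSpace.single (0 : Fin d) (1 : ℝ)) 1, ← measureReal_def]
  exact measureReal_mono Set.subset_union_left
    (measure_union_lt_top (isCompact_closedBall _ _).measure_lt_top h0.lt_top).ne

/-- `k! / W_k ^ k` is integrable, so that `limitMoment d k` is a genuine expectation. -/
theorem integrable_limitMoment (d : ℕ) [NeZero d] (k : ℕ) :
    Integrable (fun y : Fin (k - 1) → EuclideanSpace ℝ (Fin d) =>
      (k ! : ℝ) / unionVolumeRatio y ^ k) (Measure.pi fun _ => uniformUnitBall d) := by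
  have hm : Measurable (unionVolumeRatio :
      (Fin (k - 1) → EuclideanSpace ℝ (Fin d)) → ℝ) := by
    have h : MeasurableSet {q : (Fin (k - 1) → EuclideanSpace ℝ (Fin d)) ×
        EuclideanSpace ℝ (Fin d) |
        q.2 ∈ Metric.closedBall (EuclideanSpace.single (0 : Fin d) (1 : ℝ)) 1 ∪
          ⋃ i, Metric.closedBall (q.1 i) ‖q.1 i‖} := by
      simp only [Set.mem_union, Set.mem_iUnion, Metric.mem_closedBall, Set.ofPred_or,
        Set.ofPred_exists]
      refine MeasurableSet.union ?_ (MeasurableSet.iUnion fun j => ?_) <;>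
      exact measurableSet_le (by fun_prop) (by fun_prop)
    exact (measurable_measure_prodMk_left h).ennreal_toReal.div_const _
  refine Integrable.of_bound ((measurable_const.div (hm.pow_const k)).aestronglyMeasurable)
    (k ! : ℝ) (ae_of_all _ fun y => ?_)
  have h1 := one_le_pow₀ (one_le_unionVolumeRatio y) (n := k)
  rw [Real.norm_of_nonneg (by positivity)]
  exact div_le_self (by positivity) h1

/-- The conditional distribution of `n μ(S₁)` given `X₁ = x`, where `S₁` is the Voronoi cell of
`X₁` among the sample points `X₁, …, X_n`, which are `X 0, …, X (n - 1)`. -/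
def condLawFirstCellMass {d : ℕ} {Ω : Type*} [MeasurableSpace Ω] (P : Measure Ω)
    [IsProbabilityMeasure P] (μ : Measure (EuclideanSpace ℝ (Fin d)))
    (X : ℕ → Ω → EuclideanSpace ℝ (Fin d)) (n : ℕ) [NeZero n]
    (x : EuclideanSpace ℝ (Fin d)) : ProbabilityMeasure ℝ :=
  ⟨condDistrib (fun ω => scaledFirstCellMass μ n fun j : Fin n => X j ω) (X 0) P x,
    inferInstance⟩

end

/-! The proof is by the method of moments. Condition on `X₁ = x` and let `Z₁, …, Z_k` be further
independent points with law `μ`. The `k`-th power of the cell mass is the probability that all `Z_i`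
lie in the cell, that is, that no other sample point falls into the union of the open balls about
the `Z_i` with `x` on their boundary. With `n` other points, Fubini turns the `k`-th moment into `(n
+ 1) ^ k * E[(1 - M) ^ n]`, where `M` is the `μ`-mass of that union
(`integral_scaledCellMassAt_pow`). An Abelian argument shows that `P(M ≤ t) ~ c t ^ k` as `t → 0`
forces the limit `c k!` (`tendsto_pow_mul_integral_one_sub_pow`).

For `μ`-almost every `x` the density has a Lebesgue point at `x` with positive value `a`. A small
`M` forces all `Z_i` close to `x`, where `μ` is nearly `a` times Lebesgue measure. By scaling, `P(M
≤ t)` is then close to `a ^ k (t / a) ^ k c`, with `c` the volume of the set of `k`-tuples whose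
ball union about the origin has volume at most `1`. The density cancels, hence the universality
(`HasLocalDensityAt.tendsto_measureReal_div_pow`).

To compute `c`, single out the point farthest from the origin, which costs a factor `k`, and rotate
and scale it to `e₁`; the others become uniform in the unit ball. In the variable `u = ‖w‖ ^ d
λ(B_{0,1})` the radial integral is that of `u ^ (k - 1)` over `[0, 1 / W_k]`, so that `c = E[W_k ^
(-k)]` (`smallUnionVolume_mul_factorial`).

Since `W_k ≥ 1`, the limiting moments are at most `k!`. They therefore determine a law, and
convergence of moments implies weak convergence. The law of `Z` needs no separate construction: it
is the limit for one particular `μ`. -/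

/-! ### The moment problem. -/

/-- A probability measure on `ℝ` whose `k`-th moments are at most `k!` has a moment generating
function that is finite on `(-1, 1)`. -/
theorem integrable_exp_mul_of_moment_le_factorial {ν : Measure ℝ} [IsProbabilityMeasure ν]
    (hint : ∀ k : ℕ, 1 ≤ k → Integrable (fun z : ℝ => z ^ k) ν)
    (hle : ∀ k : ℕ, 1 ≤ k → ∫ z, z ^ k ∂ν ≤ k !) {t : ℝ} (ht : |t| < 1) :
    Integrable (fun z => Real.exp (t * z)) ν := by
  have hint' : ∀ k : ℕ, Integrable (fun z : ℝ => z ^ (2 * k)) ν := by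
    intro k
    rcases Nat.eq_zero_or_pos k with rfl | hk
    · simp
    · exact hint _ (by omega)
  have hle' : ∀ k : ℕ, ∫ z, z ^ (2 * k) ∂ν ≤ (2 * k)! := by
    intro k
    rcases Nat.eq_zero_or_pos k with rfl | hk
    · simp
    · exact hle _ (by omega)
  -- The series of `cosh` has only even powers, so its terms are nonnegative without a sign
  -- condition on `z` and may be integrated one by one.
  have hcosh : Integrable (fun z => Real.cosh (t * z)) ν := by
    refine ⟨by fun_prop, ?_⟩
    rw [hasFiniteIntegral_iff_ofReal (ae_of_all _ fun z => (Real.cosh_pos _).le)]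
    have h1 : ∀ z : ℝ, ENNReal.ofReal (Real.cosh (t * z)) =
        ∑' k : ℕ, ENNReal.ofReal ((t * z) ^ (2 * k) / (2 * k)!) := fun z => by
      rw [← (Real.hasSum_cosh (t * z)).tsum_eq, ENNReal.ofReal_tsum_of_nonneg _
        (Real.hasSum_cosh (t * z)).summable]
      intro k
      have := (even_two_mul k).pow_nonneg (t * z)
      positivity
    simp_rw [h1]
    rw [lintegral_tsum (fun k => by fun_prop)]
    have h2 : ∀ k : ℕ, ∫⁻ z, ENNReal.ofReal ((t * z) ^ (2 * k) / (2 * k)!) ∂ν ≤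
        ENNReal.ofReal ((t ^ 2) ^ k) := by
      intro k
      have he : (fun z : ℝ => (t * z) ^ (2 * k) / (2 * k)!) =
          fun z : ℝ => (t ^ 2) ^ k / (2 * k)! * z ^ (2 * k) := by
        ext z; rw [mul_pow, pow_mul t]; ring
      rw [lintegral_congr fun z => congrArg ENNReal.ofReal (congrFun he z),
        ← ofReal_integral_eq_lintegral_ofReal ((hint' k).const_mul _), integral_const_mul]
      · refine ENNReal.ofReal_le_ofReal ?_
        calc (t ^ 2) ^ k / (2 * k)! * ∫ z, z ^ (2 * k) ∂ν
            ≤ (t ^ 2) ^ k / (2 * k)! * (2 * k)! := by gcongr; exact hle' k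
          _ = (t ^ 2) ^ k := by field_simp
      · refine ae_of_all _ fun z => ?_
        have := (even_two_mul k).pow_nonneg z
        positivity
    refine (ENNReal.tsum_le_tsum h2).trans_lt ?_
    have hs : Summable fun k : ℕ => (t ^ 2) ^ k :=
      summable_geometric_of_lt_one (sq_nonneg t) (by rwa [sq_lt_one_iff_abs_lt_one])
    rw [← ENNReal.ofReal_tsum_of_nonneg (fun k => by positivity) hs]
    exact ENNReal.ofReal_lt_top
  refine (hcosh.const_mul 2).mono' (by fun_prop) (ae_of_all _ fun z => ?_)
  rw [Real.norm_of_nonneg (Real.exp_pos _).le, Real.cosh_eq]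
  linarith [Real.exp_pos (-(t * z))]

/-- A probability measure on `ℝ` whose `k`-th moments are at most `k!` is determined by its
moments. -/
theorem eq_of_moments_eq_of_le_factorial {ν ν' : Measure ℝ} [IsProbabilityMeasure ν]
    [IsProbabilityMeasure ν'] (hint : ∀ k : ℕ, 1 ≤ k → Integrable (fun z : ℝ => z ^ k) ν)
    (hint' : ∀ k : ℕ, 1 ≤ k → Integrable (fun z : ℝ => z ^ k) ν')
    (heq : ∀ k : ℕ, 1 ≤ k → ∫ z, z ^ k ∂ν' = ∫ z, z ^ k ∂ν)
    (hle : ∀ k : ℕ, 1 ≤ k → ∫ z, z ^ k ∂ν ≤ k !) : ν' = ν := by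
  have sub : ∀ ρ : Measure ℝ, IsProbabilityMeasure ρ →
      (∀ k : ℕ, 1 ≤ k → Integrable (fun z : ℝ => z ^ k) ρ) →
      (∀ k : ℕ, 1 ≤ k → ∫ z, z ^ k ∂ρ ≤ k !) →
      Set.Ioo (-1 : ℝ) 1 ⊆ interior (integrableExpSet id ρ) := by
    intro ρ _ h1 h2
    refine interior_maximal (fun t ht => ?_) isOpen_Ioo
    exact integrable_exp_mul_of_moment_le_factorial h1 h2 (abs_lt.mpr ht)
  have s := sub ν inferInstance hint hle
  have s' := sub ν' inferInstance hint' fun k hk => (heq k hk).trans_le (hle k hk)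
  -- The complex moment generating functions are analytic on the strip `|Re z| < 1`, and their
  -- derivatives at `0` are the moments. They agree near `0`, hence on the whole strip by the
  -- identity theorem; on the imaginary axis they are the characteristic functions.
  have an : ∀ ρ : Measure ℝ, Set.Ioo (-1 : ℝ) 1 ⊆ interior (integrableExpSet id ρ) →
      AnalyticOnNhd ℂ (complexMGF id ρ) (Complex.re ⁻¹' Set.Ioo (-1 : ℝ) 1) :=
    fun ρ h z hz => analyticAt_complexMGF (h hz)
  have zero_mem : (0 : ℂ) ∈ Complex.re ⁻¹' Set.Ioo (-1 : ℝ) 1 := by simp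
  have hder : ∀ n : ℕ, iteratedDeriv n (complexMGF id ν') 0 =
      iteratedDeriv n (complexMGF id ν) 0 := by
    intro n
    rw [iteratedDeriv_complexMGF (s' zero_mem), iteratedDeriv_complexMGF (s zero_mem)]
    simp only [id, zero_mul, Complex.exp_zero, mul_one]
    norm_cast
    rcases Nat.eq_zero_or_pos n with rfl | hn
    · simp
    · rw [heq n hn]
  have hev : complexMGF id ν' =ᶠ[𝓝 0] complexMGF id ν := by
    have h1 := (an ν' s' 0 zero_mem).hasFPowerSeriesAt
    have h2 := (an ν s 0 zero_mem).hasFPowerSeriesAt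
    simp_rw [hder] at h1
    obtain ⟨r1, h1⟩ := h1
    obtain ⟨r2, h2⟩ := h2
    have e1 := h1.eventually_hasSum
    have e2 := h2.eventually_hasSum
    rw [← zero_add (0 : ℂ), ← map_add_left_nhds_zero]
    rw [Filter.EventuallyEq, Filter.eventually_map]
    filter_upwards [e1, e2] with z hz1 hz2
    rw [add_zero]
    exact hz1.unique hz2
  have hpc : IsPreconnected (Complex.re ⁻¹' Set.Ioo (-1 : ℝ) 1) :=
    ((convex_Ioo (-1 : ℝ) 1).linear_preimage Complex.reLm).isPreconnected
  have hE := (an ν' s').eqOn_of_preconnected_of_eventuallyEq (an ν s) hpc zero_mem hev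
  refine Measure.ext_of_charFun (funext fun t => ?_)
  rw [← complexMGF_id_mul_I, ← complexMGF_id_mul_I]
  exact hE (by simp)

/-! ### From convergence of moments to weak convergence. -/

/-- Truncation of a real number to `[-K, K]`. -/
noncomputable def clampReal (K z : ℝ) : ℝ := max (-K) (min z K)

theorem continuous_clampReal (K : ℝ) : Continuous (clampReal K) := by
  unfold clampReal; fun_prop

theorem abs_clampReal_le {K : ℝ} (hK : 0 ≤ K) (z : ℝ) : |clampReal K z| ≤ K := by
  unfold clampReal
  rw [abs_le]
  constructor
  · exact le_max_left _ _
  · exact max_le (by linarith) (min_le_right _ _)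

theorem clampReal_of_abs_le {K z : ℝ} (h : |z| ≤ K) : clampReal K z = z := by
  rw [abs_le] at h
  unfold clampReal
  rw [min_eq_left h.2, max_eq_right h.1]

theorem abs_clampReal_le_abs {K : ℝ} (hK : 0 ≤ K) (z : ℝ) : |clampReal K z| ≤ |z| := by
  rcases le_or_gt |z| K with h | h
  · rw [clampReal_of_abs_le h]
  · exact (abs_clampReal_le hK z).trans h.le

/-- Where truncation acts, both powers are at most `|z| ^ k`, and `K ^ k ≤ |z| ^ k`. A bound on
moment `2k` thus controls the truncation error of moment `k` uniformly. -/
theorem abs_pow_sub_clampReal_pow_le {K : ℝ} (hK : 0 < K) (k : ℕ) (z : ℝ) :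
    |z ^ k - clampReal K z ^ k| ≤ 2 / K ^ k * z ^ (2 * k) := by
  have hn : 0 ≤ z ^ (2 * k) := (even_two_mul k).pow_nonneg z
  rcases le_or_gt |z| K with h | h
  · rw [clampReal_of_abs_le h, sub_self, abs_zero]
    positivity
  · calc |z ^ k - clampReal K z ^ k| ≤ |z ^ k| + |clampReal K z ^ k| := abs_sub _ _
      _ ≤ |z| ^ k + |z| ^ k := by
          rw [abs_pow, abs_pow]
          exact add_le_add_right
            (pow_le_pow_left₀ (abs_nonneg _) (abs_clampReal_le_abs hK.le z) k) _
      _ = 2 * (K ^ k * |z| ^ k) / K ^ k := by field_simp; ring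
      _ ≤ 2 * (|z| ^ k * |z| ^ k) / K ^ k := by gcongr
      _ = 2 / K ^ k * z ^ (2 * k) := by
          rw [← pow_add, ← two_mul, ← abs_pow, abs_of_nonneg hn]; ring

/-- The truncated power `z ↦ (clampReal K z) ^ k` as a bounded continuous function. -/
noncomputable def clampPow (K : ℝ) (k : ℕ) : BoundedContinuousFunction ℝ ℝ :=
  BoundedContinuousFunction.ofNormedAddCommGroup (fun z => clampReal |K| z ^ k)
    ((continuous_clampReal _).pow k) (|K| ^ k) fun z => by
      rw [norm_pow, Real.norm_eq_abs]
      exact pow_le_pow_left₀ (abs_nonneg _) (abs_clampReal_le (abs_nonneg K) z) k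

theorem clampPow_apply {K : ℝ} (hK : 0 < K) (k : ℕ) (z : ℝ) :
    clampPow K k z = clampReal K z ^ k := by
  simp [clampPow, abs_of_pos hK]

/-- The sequence is eventually constant; the shift by one keeps the level positive, as
`clampPow_apply` requires. -/
theorem tendsto_clampReal_atTop (z : ℝ) :
    Tendsto (fun K : ℕ => clampReal (K + 1 : ℕ) z) atTop (𝓝 z) := by
  refine tendsto_const_nhds.congr' ?_
  obtain ⟨N, hN⟩ := exists_nat_ge |z|
  filter_upwards [eventually_ge_atTop N] with K hK
  refine (clampReal_of_abs_le (hN.trans ?_)).symm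
  exact_mod_cast hK.trans (Nat.le_succ K)

/-- A weak limit point of probability measures on `[0, ∞)` whose moments converge is supported by
`[0, ∞)` and has the limits as moments. -/
theorem moments_of_tendsto {L : ℕ → ProbabilityMeasure ℝ} {m : ℕ → ℝ}
    (hpos : ∀ n, ∀ᵐ z ∂(L n : Measure ℝ), 0 ≤ z)
    (hint : ∀ n k, Integrable (fun z : ℝ => z ^ k) (L n : Measure ℝ))
    (hm : ∀ k, 1 ≤ k → Tendsto (fun n => ∫ z, z ^ k ∂(L n : Measure ℝ)) atTop (𝓝 (m k)))
    {F : Filter ℕ} [F.NeBot] (hF : F ≤ atTop) {ν : ProbabilityMeasure ℝ}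
    (hν : Tendsto L F (𝓝 ν)) :
    (∀ᵐ z ∂(ν : Measure ℝ), 0 ≤ z) ∧ ∀ k, 1 ≤ k → Integrable (fun z : ℝ => z ^ k) (ν : Measure ℝ) ∧
      ∫ z, z ^ k ∂(ν : Measure ℝ) = m k := by
  have hT := ProbabilityMeasure.tendsto_iff_forall_integral_tendsto.mp hν
  constructor
  -- A bounded continuous test function that vanishes exactly on `[0, ∞)`.
  · let g : BoundedContinuousFunction ℝ ℝ :=
      BoundedContinuousFunction.ofNormedAddCommGroup (fun z => min (max (-z) 0) 1)
        (by fun_prop) 1 (fun z => by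
          rw [Real.norm_of_nonneg (by positivity)]
          exact min_le_right _ _)
    have hg : ∀ z, g z = min (max (-z) 0) 1 := fun z => rfl
    have h0 : ∀ n, ∫ z, g z ∂(L n : Measure ℝ) = 0 := fun n => by
      refine integral_eq_zero_of_ae ?_
      filter_upwards [hpos n] with z hz
      simp [hg, hz]
    have h1 : ∫ z, g z ∂(ν : Measure ℝ) = 0 := by
      refine tendsto_nhds_unique (hT g) ?_
      simp_rw [h0]
      exact tendsto_const_nhds
    rw [integral_eq_zero_iff_of_nonneg (fun z => by simp [hg]) (g.integrable _)] at h1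
    filter_upwards [h1] with z hz
    by_contra! hneg
    have : 0 < g z := by
      rw [hg]
      exact lt_min (lt_max_of_lt_left (by linarith)) one_pos
    exact this.ne' hz
  · intro k hk
    have hC : ∃ C, ∀ n, ∫ z, z ^ (2 * k) ∂(L n : Measure ℝ) ≤ C := by
      obtain ⟨C, hC⟩ := (hm (2 * k) (by omega)).bddAbove_range
      exact ⟨C, fun n => hC ⟨n, rfl⟩⟩
    obtain ⟨C, hC⟩ := hC
    have hCν : ∀ K : ℕ, ∫ z, clampPow (K + 1 : ℕ) (2 * k) z ∂(ν : Measure ℝ) ≤ C := by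
      intro K
      refine le_of_tendsto (hT _) (Eventually.of_forall fun n => ?_)
      refine le_trans (integral_mono (BoundedContinuousFunction.integrable _ _) (hint n _)
        fun z => ?_) (hC n)
      rw [clampPow_apply (by positivity), pow_mul, pow_mul]
      exact pow_le_pow_left₀ (sq_nonneg _)
        (sq_le_sq.mpr (abs_clampReal_le_abs (by positivity) z)) k
    -- Fatou's lemma removes the truncation from `hCν`.
    have hi2 : Integrable (fun z : ℝ => z ^ (2 * k)) (ν : Measure ℝ) := by
      refine ⟨by fun_prop, ?_⟩
      rw [hasFiniteIntegral_iff_ofReal (ae_of_all _ fun z => (even_two_mul k).pow_nonneg z)]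
      have hl : ∀ z : ℝ, ENNReal.ofReal (z ^ (2 * k)) =
          liminf (fun K : ℕ => ENNReal.ofReal (clampPow (K + 1 : ℕ) (2 * k) z)) atTop := by
        intro z
        refine (Tendsto.liminf_eq ?_).symm
        refine (ENNReal.continuous_ofReal.tendsto _).comp ?_
        simp_rw [clampPow_apply (Nat.cast_pos.mpr (Nat.succ_pos _))]
        exact (tendsto_clampReal_atTop z).pow _
      simp_rw [hl]
      refine (lintegral_liminf_le fun K => ?_).trans_lt ?_
      · exact ((clampPow _ _).continuous.measurable).ennreal_ofReal
      · refine lt_of_le_of_lt ?_ (ENNReal.ofReal_lt_top (r := C))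
        refine liminf_le_of_le (by isBoundedDefault) fun b hb => ?_
        obtain ⟨K, hK⟩ := hb.exists
        refine hK.trans ?_
        rw [← ofReal_integral_eq_lintegral_ofReal (BoundedContinuousFunction.integrable _ _)]
        · exact ENNReal.ofReal_le_ofReal (hCν K)
        · refine ae_of_all _ fun z => ?_
          rw [clampPow_apply (by positivity)]
          exact (even_two_mul k).pow_nonneg _
    have hi : Integrable (fun z : ℝ => z ^ k) (ν : Measure ℝ) := by
      refine ((integrable_const (1 : ℝ)).add hi2).mono' (by fun_prop) (ae_of_all _ fun z => ?_)
      simp only [Pi.add_apply]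
      rw [mul_comm, pow_mul, Real.norm_eq_abs, ← sq_abs (z ^ k)]
      nlinarith [sq_nonneg (|z ^ k| - 1)]
    refine ⟨hi, ?_⟩
    -- The truncation error is uniform in `n`, so the limit along `F` comes first and `K → ∞`
    -- afterwards.
    have hclose : ∀ K : ℕ, |∫ z, clampPow (K + 1 : ℕ) k z ∂(ν : Measure ℝ) - m k| ≤
        2 / ((K + 1 : ℕ) : ℝ) ^ k * C := by
      intro K
      refine le_of_tendsto (((hT _).sub ((hm k hk).mono_left hF)).abs)
        (Eventually.of_forall fun n => ?_)
      rw [← integral_sub (BoundedContinuousFunction.integrable _ _) (hint n k)]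
      calc _ ≤ ∫ z, 2 / ((K + 1 : ℕ) : ℝ) ^ k * z ^ (2 * k) ∂(L n : Measure ℝ) := by
            refine (abs_integral_le_integral_abs).trans (integral_mono_of_nonneg
              (ae_of_all _ fun z => abs_nonneg _) ((hint n _).const_mul _) (ae_of_all _ fun z => ?_))
            dsimp only
            rw [clampPow_apply (by positivity), abs_sub_comm]
            exact abs_pow_sub_clampReal_pow_le (by positivity) k z
        _ ≤ _ := by
            rw [integral_const_mul]
            gcongr
            exact hC n
    have hlim1 : Tendsto (fun K : ℕ => ∫ z, clampPow (K + 1 : ℕ) k z ∂(ν : Measure ℝ)) atTop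
        (𝓝 (∫ z, z ^ k ∂(ν : Measure ℝ))) := by
      refine tendsto_integral_of_dominated_convergence (fun z => |z ^ k|)
        (fun K => (clampPow _ _).continuous.aestronglyMeasurable) hi.abs
        (fun K => ae_of_all _ fun z => ?_) (ae_of_all _ fun z => ?_)
      · rw [clampPow_apply (by positivity), Real.norm_eq_abs, abs_pow, abs_pow]
        exact pow_le_pow_left₀ (abs_nonneg _) (abs_clampReal_le_abs (by positivity) z) k
      · simp_rw [clampPow_apply (Nat.cast_pos.mpr (Nat.succ_pos _))]
        exact (tendsto_clampReal_atTop z).pow _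
    have hlim2 : Tendsto (fun K : ℕ => 2 / ((K + 1 : ℕ) : ℝ) ^ k * C) atTop (𝓝 0) := by
      have h3 : Tendsto (fun K : ℕ => ((K + 1 : ℕ) : ℝ) ^ k) atTop atTop :=
        (tendsto_pow_atTop (by omega)).comp
          (tendsto_natCast_atTop_atTop.comp (tendsto_add_atTop_nat 1))
      simpa using (h3.const_div_atTop 2).mul_const C
    have h0 := squeeze_zero (fun K => abs_nonneg _) hclose hlim2
    exact tendsto_nhds_unique hlim1 ((tendsto_sub_nhds_zero_iff).mp
      ((tendsto_zero_iff_abs_tendsto_zero _).mpr h0))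

/-- Probability measures on `[0, ∞)` whose `k`-th moments converge to numbers `m k ≤ k!` converge
weakly to a probability measure with moments `m k`. -/
theorem exists_tendsto_of_moments_tendsto {L : ℕ → ProbabilityMeasure ℝ} {m : ℕ → ℝ}
    (hpos : ∀ n, ∀ᵐ z ∂(L n : Measure ℝ), 0 ≤ z)
    (hint : ∀ n k, Integrable (fun z : ℝ => z ^ k) (L n : Measure ℝ))
    (hm : ∀ k, 1 ≤ k → Tendsto (fun n => ∫ z, z ^ k ∂(L n : Measure ℝ)) atTop (𝓝 (m k)))
    (hle : ∀ k, 1 ≤ k → m k ≤ k !) :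
    ∃ ν : ProbabilityMeasure ℝ, (∀ᵐ z ∂(ν : Measure ℝ), 0 ≤ z) ∧
      (∀ k, 1 ≤ k → Integrable (fun z : ℝ => z ^ k) (ν : Measure ℝ) ∧
        ∫ z, z ^ k ∂(ν : Measure ℝ) = m k) ∧ Tendsto L atTop (𝓝 ν) := by
  -- Bounded second moments give tightness by Chebyshev's inequality; Prokhorov's theorem gives
  -- compactness.
  have hcomp : IsCompact (closure (Set.range L)) := by
    refine isCompact_closure_of_isTightMeasureSet ?_
    refine isTightMeasureSet_of_tendsto_measure_norm_gt ?_
    obtain ⟨C, hC⟩ := (hm 2 one_le_two).bddAbove_range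
    have hb : ∀ r : ℝ, 0 < r → ∀ n, (L n : Measure ℝ) {z | r < ‖z‖} ≤ ENNReal.ofReal (C / r ^ 2) := by
      intro r hr n
      have h1 := mul_meas_ge_le_integral_of_nonneg (μ := (L n : Measure ℝ)) (f := fun z => z ^ 2)
        (ae_of_all _ fun z => sq_nonneg z) (hint n 2) (r ^ 2)
      have h2 : (L n : Measure ℝ).real {z | r ^ 2 ≤ z ^ 2} ≤ C / r ^ 2 := by
        rw [le_div_iff₀ (by positivity), mul_comm]
        exact h1.trans (hC ⟨n, rfl⟩)
      refine le_trans (measure_mono (t := {z | r ^ 2 ≤ z ^ 2}) fun z hz => ?_) ?_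
      · rw [Set.mem_ofPred_eq, sq_le_sq, abs_of_pos hr]
        exact hz.le
      · rw [← ofReal_measureReal]
        exact ENNReal.ofReal_le_ofReal h2
    refine tendsto_of_tendsto_of_tendsto_of_le_of_le' (tendsto_const_nhds (x := 0))
      (h := fun r : ℝ => ENNReal.ofReal (C / r ^ 2)) ?_ (Eventually.of_forall fun r => zero_le)
      ?_
    · rw [← ENNReal.ofReal_zero]
      exact (ENNReal.continuous_ofReal.tendsto _).comp
        ((tendsto_pow_atTop two_ne_zero).const_div_atTop C)
    · filter_upwards [eventually_gt_atTop 0] with r hr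
      simp only [iSup_le_iff]
      rintro _ ⟨_, ⟨n, rfl⟩, rfl⟩
      exact hb r hr n
  have hclus : ∀ ν, MapClusterPt ν atTop L → (∀ᵐ z ∂(ν : Measure ℝ), 0 ≤ z) ∧
      ∀ k, 1 ≤ k → Integrable (fun z : ℝ => z ^ k) (ν : Measure ℝ) ∧
        ∫ z, z ^ k ∂(ν : Measure ℝ) = m k := by
    intro ν hν
    -- A cluster point is a limit along an ultrafilter below `atTop`, which is why
    -- `moments_of_tendsto` allows a general filter.
    obtain ⟨U, hU, hUν⟩ := mapClusterPt_iff_ultrafilter.mp hν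
    exact moments_of_tendsto hpos hint hm hU hUν
  have hmem : ∀ᶠ n in atTop, L n ∈ closure (Set.range L) :=
    Eventually.of_forall fun n => subset_closure ⟨n, rfl⟩
  obtain ⟨ν, -, hν⟩ := hcomp.exists_mapClusterPt_of_frequently hmem.frequently
  refine ⟨ν, (hclus ν hν).1, (hclus ν hν).2, ?_⟩
  refine hcomp.tendsto_nhds_of_unique_mapClusterPt hmem fun ν' _ hν' => ?_
  have h := (hclus ν hν).2
  have h' := (hclus ν' hν').2
  refine Subtype.ext (eq_of_moments_eq_of_le_factorial (ν := (ν : Measure ℝ))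
    (ν' := (ν' : Measure ℝ)) (fun k hk => (h k hk).1)
    (fun k hk => (h' k hk).1) (fun k hk => ?_) fun k hk => ?_)
  · rw [(h k hk).2, (h' k hk).2]
  · rw [(h k hk).2]; exact hle k hk

/-! ### An Abelian theorem for `E[(1 - M) ^ n]`. -/

/-- The integrand is the derivative of `-(1 - t) ^ (n + 1)`. The indicator keeps the domain
independent of `m`, ready for Fubini. -/
theorem integral_Ioc_indicator_one_sub_pow {m : ℝ} (h0 : 0 ≤ m) (h1 : m ≤ 1) (n : ℕ) :
    ∫ t in Set.Ioc (0 : ℝ) 1, (Set.Ici m).indicator (fun t => (n + 1 : ℝ) * (1 - t) ^ n) t =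
      (1 - m) ^ (n + 1) := by
  have hs : (Set.Ioc (0 : ℝ) 1 ∩ Set.Ici m : Set ℝ) =ᵐ[volume] (Set.Ioc m 1 : Set ℝ) := by
    have : Set.Ioc (0 : ℝ) 1 ∩ Set.Ioi m = Set.Ioc m 1 := by
      ext t; simp only [Set.mem_inter_iff, Set.mem_Ioc, Set.mem_Ioi]; grind
    rw [← this]
    exact (ae_eq_refl _).inter Ioi_ae_eq_Ici.symm
  rw [setIntegral_indicator measurableSet_Ici, setIntegral_congr_set hs,
    ← intervalIntegral.integral_of_le h1]
  have hd : ∀ t ∈ Set.uIcc m 1, HasDerivAt (fun t : ℝ => -(1 - t) ^ (n + 1))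
      ((n + 1 : ℝ) * (1 - t) ^ n) t := by
    intro t _
    have := (((hasDerivAt_id t).const_sub 1).pow (n + 1)).neg
    refine this.congr_deriv ?_
    simp
  rw [intervalIntegral.integral_eq_sub_of_hasDerivAt hd (by
    apply Continuous.intervalIntegrable; fun_prop)]
  simp

/-- Layer cake formula for `E[(1 - M) ^ (n + 1)]`. -/
theorem integral_one_sub_pow_eq {X : Type*} [MeasurableSpace X] (ρ : Measure X)
    [IsProbabilityMeasure ρ] {M : X → ℝ} (hM : Measurable M) (h0 : ∀ x, 0 ≤ M x)
    (h1 : ∀ x, M x ≤ 1) (n : ℕ) :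
    ∫ x, (1 - M x) ^ (n + 1) ∂ρ =
      ∫ t in Set.Ioc (0 : ℝ) 1, (n + 1 : ℝ) * (1 - t) ^ n * ρ.real {x | M x ≤ t} := by
  simp_rw [← integral_Ioc_indicator_one_sub_pow (h0 _) (h1 _) n]
  rw [integral_integral_swap]
  · refine integral_congr_ae (ae_of_all _ fun t => ?_)
    have : ∀ x, (Set.Ici (M x)).indicator (fun t => (n + 1 : ℝ) * (1 - t) ^ n) t =
        {x | M x ≤ t}.indicator (fun _ => (n + 1 : ℝ) * (1 - t) ^ n) x := fun x => by
      simp [Set.indicator_apply]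
    simp_rw [this]
    rw [integral_indicator_const _ (measurableSet_le hM measurable_const), smul_eq_mul, mul_comm]
  · have hset : MeasurableSet {q : X × ℝ | M q.1 ≤ q.2} :=
      measurableSet_le (by fun_prop) (by fun_prop)
    have heq : Function.uncurry (fun x t => (Set.Ici (M x)).indicator
        (fun t => (n + 1 : ℝ) * (1 - t) ^ n) t) =
        {q : X × ℝ | M q.1 ≤ q.2}.indicator (fun q => (n + 1 : ℝ) * (1 - q.2) ^ n) := by
      ext ⟨x, t⟩; simp [Set.indicator_apply]
    rw [heq]
    refine Integrable.of_bound
      ((Measurable.indicator (by fun_prop) hset).aestronglyMeasurable) (n + 1 : ℝ) ?_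
    have hae : ∀ᵐ q ∂(ρ.prod (volume.restrict (Set.Ioc (0 : ℝ) 1))), q.2 ∈ Set.Ioc (0 : ℝ) 1 :=
      Measure.quasiMeasurePreserving_snd.ae (ae_restrict_mem measurableSet_Ioc)
    filter_upwards [hae] with q hq
    refine (norm_indicator_le_norm_self _ _).trans ?_
    have h2 : 0 ≤ 1 - q.2 := by linarith [hq.2]
    rw [Real.norm_of_nonneg (by positivity)]
    exact mul_le_of_le_one_right (by positivity) (pow_le_one₀ h2 (by linarith [hq.1]))

theorem integral_Ioi_pow_mul_exp_neg (k : ℕ) :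
    ∫ s in Set.Ioi (0 : ℝ), s ^ k * Real.exp (-s) = k ! := by
  rw [← Real.Gamma_nat_eq_factorial, Real.Gamma_eq_integral (by positivity)]
  refine integral_congr_ae (ae_of_all _ fun s => ?_)
  simp only [add_sub_cancel_right, Real.rpow_natCast]
  ring

/-- The rate `1 / 2` comes from `(1 - s / (n + 1)) ^ n ≤ exp (-s n / (n + 1))` and `n / (n + 1) ≥ 1
/ 2` for `n ≥ 1`. -/
theorem integrableOn_pow_mul_exp_neg_half (k : ℕ) :
    IntegrableOn (fun s : ℝ => s ^ k * Real.exp (-s / 2)) (Set.Ioi 0) := by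
  have := integrableOn_rpow_mul_exp_neg_mul_rpow (p := 1) (s := k) (b := 1 / 2)
    (neg_one_lt_zero.trans_le k.cast_nonneg) one_pos one_half_pos
  refine this.congr_fun (fun s _ => ?_) measurableSet_Ioi
  simp only [Real.rpow_natCast, Real.rpow_one]
  ring_nf

/-- If `P(M ≤ t) ~ c t ^ k` as `t → 0`, then `n ^ k E[(1 - M) ^ n] → c k!`. -/
theorem tendsto_pow_mul_integral_one_sub_pow {X : Type*} [MeasurableSpace X] (ρ : Measure X)
    [IsProbabilityMeasure ρ] {M : X → ℝ} (hM : Measurable M) (h0 : ∀ x, 0 ≤ M x)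
    (h1 : ∀ x, M x ≤ 1) (k : ℕ) {c : ℝ}
    (hc : Tendsto (fun t => ρ.real {x | M x ≤ t} / t ^ k) (𝓝[>] 0) (𝓝 c)) :
    Tendsto (fun n : ℕ => (n + 1 : ℝ) ^ k * ∫ x, (1 - M x) ^ n ∂ρ) atTop (𝓝 (c * k !)) := by
  set F : ℝ → ℝ := fun t => ρ.real {x | M x ≤ t} with hF
  have hF0 : ∀ t, 0 ≤ F t := fun t => measureReal_nonneg
  have hF1 : ∀ t, F t ≤ 1 := fun t => measureReal_le_one
  have hFmono : Monotone F := fun s t hst =>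
    measureReal_mono fun x (hx : M x ≤ s) => hx.trans hst
  -- Near `0` the bound comes from the limit; for `t ≥ δ` it follows from `F ≤ 1 ≤ t ^ k / δ ^ k`.
  obtain ⟨C, hC0, hC⟩ : ∃ C, 0 ≤ C ∧ ∀ t, 0 < t → F t ≤ C * t ^ k := by
    have hev : ∀ᶠ t in 𝓝[>] (0 : ℝ), F t / t ^ k ≤ |c| + 1 :=
      (hc.eventually_lt_const (lt_of_le_of_lt (le_abs_self c) (lt_add_one _))).mono
        fun _ h => h.le
    obtain ⟨δ, hδ, hδ'⟩ := mem_nhdsGT_iff_exists_Ioo_subset.mp hev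
    have hδ : 0 < δ := hδ
    refine ⟨|c| + 1 + (δ ^ k)⁻¹, by positivity, fun t ht => ?_⟩
    rcases lt_or_ge t δ with h | h
    · have h2 : F t / t ^ k ≤ |c| + 1 := hδ' ⟨ht, h⟩
      rw [div_le_iff₀ (by positivity)] at h2
      refine h2.trans ?_
      exact mul_le_mul_of_nonneg_right (le_add_of_nonneg_right (by positivity)) (by positivity)
    · calc F t ≤ 1 := hF1 t
        _ = (δ ^ k)⁻¹ * δ ^ k := by field_simp
        _ ≤ (|c| + 1 + (δ ^ k)⁻¹) * t ^ k := by
          gcongr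
          exact le_add_of_nonneg_left (by positivity)
  rw [← tendsto_add_atTop_iff_nat 1]
  -- The layer cake integrand after substituting `t = s / (n + 1)`. The prefactor is now `(n + 2) ^
  -- k`, hence the ratio in `hrew`, which tends to `1`.
  set G : ℕ → ℝ → ℝ := fun n => (Set.Ioc (0 : ℝ) (n + 1)).indicator fun s =>
    (1 - s / (n + 1)) ^ n * ((n + 1) ^ k * F (s / (n + 1))) with hG
  have hrew : ∀ n : ℕ, ((n + 1 : ℕ) + 1 : ℝ) ^ k * ∫ x, (1 - M x) ^ (n + 1) ∂ρ =
      (((n + 1 : ℕ) + 1 : ℝ) / (n + 1)) ^ k * ∫ s in Set.Ioi (0 : ℝ), G n s := by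
    intro n
    have hn : (n + 1 : ℝ) ≠ 0 := by positivity
    rw [integral_one_sub_pow_eq ρ hM h0 h1, ← intervalIntegral.integral_of_le zero_le_one]
    have hsub := intervalIntegral.integral_comp_div (a := 0) (b := n + 1)
      (fun t => (n + 1 : ℝ) * (1 - t) ^ n * F t) hn
    rw [zero_div, div_self hn, smul_eq_mul] at hsub
    rw [hG]
    simp only
    rw [setIntegral_indicator measurableSet_Ioc,
      Set.inter_eq_self_of_subset_right Set.Ioc_subset_Ioi_self,
      ← intervalIntegral.integral_of_le (by positivity), div_pow]
    have e : ∀ s : ℝ, (1 - s / (n + 1)) ^ n * ((n + 1 : ℝ) ^ k * F (s / (n + 1))) =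
        (n + 1 : ℝ) ^ k / (n + 1) * ((n + 1 : ℝ) * (1 - s / (n + 1)) ^ n * F (s / (n + 1))) := by
      intro s; field_simp
    simp_rw [e]
    rw [intervalIntegral.integral_const_mul, hsub]
    field_simp
    rfl
  have hlim : Tendsto (fun n : ℕ => ∫ s in Set.Ioi (0 : ℝ), G n s) atTop
      (𝓝 (∫ s in Set.Ioi (0 : ℝ), c * (s ^ k * Real.exp (-s)))) := by
    have hGm : ∀ n, Measurable (G n) := fun n => by
      refine Measurable.indicator ?_ measurableSet_Ioc
      have := hFmono.measurable
      fun_prop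
    -- The second summand of the dominating function only serves `n = 0`, where the power `n` gives
    -- no exponential decay.
    refine tendsto_integral_of_dominated_convergence
      (fun s => C * (s ^ k * Real.exp (-s / 2)) + (Set.Ioc (0 : ℝ) 1).indicator (fun _ => C) s)
      (fun n => (hGm n).aestronglyMeasurable) ?_ (fun n => ?_) ?_
    · refine ((integrableOn_pow_mul_exp_neg_half k).const_mul C).add ?_
      refine (IntegrableOn.integrable_indicator ?_ measurableSet_Ioc).restrict
      exact integrableOn_const (by simp)
    · filter_upwards [ae_restrict_mem measurableSet_Ioi] with s hs
      have hs : 0 < s := hs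
      have hi : 0 ≤ (Set.Ioc (0 : ℝ) 1).indicator (fun _ => C) s :=
        Set.indicator_nonneg (fun _ _ => hC0) s
      by_cases hsn : s ≤ n + 1
      swap
      · have : G n s = 0 := Set.indicator_of_notMem (fun h => hsn h.2) _
        rw [this, norm_zero]
        positivity
      have hGs : G n s = (1 - s / (n + 1)) ^ n * ((n + 1) ^ k * F (s / (n + 1))) :=
        Set.indicator_of_mem (show s ∈ Set.Ioc (0 : ℝ) (n + 1) from ⟨hs, hsn⟩) _
      have hd : 0 ≤ 1 - s / (n + 1) := by
        rw [sub_nonneg, div_le_one (by positivity)]; exact hsn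
      have hFs : (n + 1 : ℝ) ^ k * F (s / (n + 1)) ≤ C * s ^ k := by
        have := hC (s / (n + 1)) (by positivity)
        rw [div_pow, mul_div_assoc', le_div_iff₀ (by positivity)] at this
        linarith
      rw [hGs, Real.norm_of_nonneg (by have := hF0 (s / (n + 1)); positivity)]
      rcases Nat.eq_zero_or_pos n with rfl | hn
      · have hs1 : s ≤ 1 := by simpa using hsn
        have : (Set.Ioc (0 : ℝ) 1).indicator (fun _ => C) s = C :=
          Set.indicator_of_mem (show s ∈ Set.Ioc (0 : ℝ) 1 from ⟨hs, hs1⟩) _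
        rw [this, pow_zero, one_mul]
        have : C * s ^ k ≤ C := mul_le_of_le_one_right hC0 (pow_le_one₀ hs.le hs1)
        have : 0 ≤ C * (s ^ k * Real.exp (-s / 2)) := by positivity
        linarith
      · have hexp : (1 - s / (n + 1)) ^ n ≤ Real.exp (-s / 2) := by
          calc (1 - s / (n + 1)) ^ n ≤ Real.exp (-(s / (n + 1))) ^ n := by
                gcongr
                exact Real.one_sub_le_exp_neg _
            _ = Real.exp (n * -(s / (n + 1))) := (Real.exp_nat_mul _ _).symm
            _ ≤ Real.exp (-s / 2) := by
                rw [Real.exp_le_exp]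
                have hn1 : (1 : ℝ) ≤ n := by exact_mod_cast hn
                have : s / 2 ≤ n * (s / (n + 1)) := by
                  rw [mul_div_assoc', div_le_div_iff₀ two_pos (by positivity)]
                  nlinarith
                linarith
        calc (1 - s / (n + 1)) ^ n * ((n + 1) ^ k * F (s / (n + 1)))
            ≤ Real.exp (-s / 2) * (C * s ^ k) := by
              gcongr
          _ ≤ _ := by nlinarith
    · filter_upwards [ae_restrict_mem measurableSet_Ioi] with s hs
      have hs : 0 < s := hs
      have hcast : Tendsto (fun n : ℕ => (n : ℝ) + 1) atTop atTop :=
        tendsto_atTop_add_const_right _ _ tendsto_natCast_atTop_atTop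
      have hdiv : Tendsto (fun n : ℕ => s / ((n : ℝ) + 1)) atTop (𝓝 0) :=
        hcast.const_div_atTop s
      have hone : Tendsto (fun n : ℕ => 1 - s / ((n : ℝ) + 1)) atTop (𝓝 1) := by
        simpa using hdiv.const_sub 1
      -- The power `n + 1` has the classical limit; the extra factor tends to `1` and is divided
      -- out.
      have hE : Tendsto (fun n : ℕ => (1 - s / ((n : ℝ) + 1)) ^ n) atTop (𝓝 (Real.exp (-s))) := by
        have h3 := (tendsto_add_atTop_iff_nat 1).mpr (Real.tendsto_one_add_div_pow_exp (-s))
        have h4 := h3.div hone one_ne_zero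
        rw [div_one] at h4
        refine h4.congr' ?_
        filter_upwards [hone.eventually_const_lt one_half_lt_one] with n hn
        have : 1 - s / ((n : ℝ) + 1) ≠ 0 := by linarith
        simp only [Pi.div_apply, Nat.cast_add, Nat.cast_one]
        rw [neg_div, ← sub_eq_add_neg, pow_succ, mul_div_cancel_right₀ _ this]
      have hFl : Tendsto (fun n : ℕ => ((n : ℝ) + 1) ^ k * F (s / (n + 1))) atTop
          (𝓝 (c * s ^ k)) := by
        have h5 : Tendsto (fun n : ℕ => s / ((n : ℝ) + 1)) atTop (𝓝[>] 0) :=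
          tendsto_nhdsWithin_iff.mpr ⟨hdiv, Eventually.of_forall fun n => by
            rw [Set.mem_Ioi]; positivity⟩
        refine ((hc.comp h5).mul_const (s ^ k)).congr fun n => ?_
        change F (s / (n + 1)) / (s / (n + 1)) ^ k * s ^ k = _
        rw [div_pow]
        generalize F (s / (n + 1)) = y
        field_simp
      have := hE.mul hFl
      rw [show c * (s ^ k * Real.exp (-s)) = Real.exp (-s) * (c * s ^ k) by ring]
      refine this.congr' ?_
      filter_upwards [hcast.eventually_ge_atTop s] with n hn
      simp only [hG]
      rw [Set.indicator_of_mem (show s ∈ Set.Ioc (0 : ℝ) (n + 1) from ⟨hs, hn⟩)]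
  rw [integral_const_mul, integral_Ioi_pow_mul_exp_neg] at hlim
  have hratio : Tendsto (fun n : ℕ => (((n + 1 : ℕ) + 1 : ℝ) / (n + 1)) ^ k) atTop (𝓝 1) := by
    have : Tendsto (fun n : ℕ => ((n + 1 : ℕ) + 1 : ℝ) / (n + 1)) atTop (𝓝 1) := by
      have h6 := (tendsto_one_div_add_atTop_nhds_zero_nat (𝕜 := ℝ)).const_add 1
      rw [add_zero] at h6
      refine h6.congr fun n => ?_
      push_cast
      field_simp
    simpa using this.pow k
  have := hratio.mul hlim
  rw [one_mul] at this
  exact this.congr fun n => (hrew n).symm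

/-! ### Ball unions and their scaling. -/

/-- The union of the open balls about the points `z i` that have `x` on their boundary. -/
def ballUnion {d : ℕ} {ι : Type*} (x : EuclideanSpace ℝ (Fin d))
    (z : ι → EuclideanSpace ℝ (Fin d)) : Set (EuclideanSpace ℝ (Fin d)) :=
  ⋃ i, Metric.ball (z i) (dist (z i) x)

/-- The volume of the unit ball of `ℝ^d`. -/
noncomputable def unitBallVolume (d : ℕ) : ℝ :=
  volume.real (Metric.closedBall (0 : EuclideanSpace ℝ (Fin d)) 1)

section

variable {d : ℕ} {ι : Type*}

theorem isOpen_ballUnion (x : EuclideanSpace ℝ (Fin d)) (z : ι → EuclideanSpace ℝ (Fin d)) :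
    IsOpen (ballUnion x z) :=
  isOpen_iUnion fun _ => Metric.isOpen_ball

theorem mem_ballUnion {x w : EuclideanSpace ℝ (Fin d)} {z : ι → EuclideanSpace ℝ (Fin d)} :
    w ∈ ballUnion x z ↔ ∃ i, dist w (z i) < dist (z i) x := by
  simp [ballUnion]

theorem measurable_measureReal_ballUnion [Countable ι]
    (μ : Measure (EuclideanSpace ℝ (Fin d))) [SFinite μ] (x : EuclideanSpace ℝ (Fin d)) :
    Measurable fun z : ι → EuclideanSpace ℝ (Fin d) => μ.real (ballUnion x z) := by
  have h : MeasurableSet {q : (ι → EuclideanSpace ℝ (Fin d)) × EuclideanSpace ℝ (Fin d) |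
      q.2 ∈ ballUnion x q.1} := by
    simp only [mem_ballUnion, Set.ofPred_exists]
    exact MeasurableSet.iUnion fun i => measurableSet_lt (by fun_prop) (by fun_prop)
  exact (measurable_measure_prodMk_left h).ennreal_toReal

theorem unitBallVolume_pos : 0 < unitBallVolume d :=
  ENNReal.toReal_pos (Metric.measure_closedBall_pos _ _ one_pos).ne'
    (isCompact_closedBall _ _).measure_lt_top.ne

theorem volume_real_closedBall (x : EuclideanSpace ℝ (Fin d)) {r : ℝ} (hr : 0 ≤ r) :
    volume.real (Metric.closedBall x r) = r ^ d * unitBallVolume d := by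
  rw [Measure.addHaar_real_closedBall' _ _ hr, finrank_euclideanSpace_fin, unitBallVolume]

theorem volume_real_ball [NeZero d] (x : EuclideanSpace ℝ (Fin d)) {r : ℝ} (hr : 0 ≤ r) :
    volume.real (Metric.ball x r) = r ^ d * unitBallVolume d := by
  rw [← Measure.addHaar_real_closedBall_eq_addHaar_real_ball, volume_real_closedBall x hr]

theorem measureReal_ball_le_ballUnion [Finite ι] (μ : Measure (EuclideanSpace ℝ (Fin d)))
    [IsLocallyFiniteMeasure μ] (x : EuclideanSpace ℝ (Fin d))
    (z : ι → EuclideanSpace ℝ (Fin d)) (i : ι) :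
    μ.real (Metric.ball (z i) (dist (z i) x)) ≤ μ.real (ballUnion x z) := by
  refine measureReal_mono (Set.subset_iUnion (fun i => Metric.ball (z i) (dist (z i) x)) i) ?_
  exact ((measure_mono (Set.iUnion_mono fun i => Metric.ball_subset_closedBall)).trans_lt
    (isCompact_iUnion fun i => isCompact_closedBall _ _).measure_lt_top).ne

theorem volume_real_ballUnion_dilation (x : EuclideanSpace ℝ (Fin d)) {ρ : ℝ} (hρ : 0 < ρ)
    (z : ι → EuclideanSpace ℝ (Fin d)) :
    volume.real (ballUnion x fun i => x + ρ • z i) = ρ ^ d * volume.real (ballUnion 0 z) := by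
  have h : (fun w => ρ • w) ⁻¹' ((fun w => x + w) ⁻¹' ballUnion x fun i => x + ρ • z i) =
      ballUnion 0 z := by
    ext w
    simp only [Set.mem_preimage, mem_ballUnion, dist_add_left, dist_smul₀, dist_self_add_left,
      norm_smul, dist_zero_right]
    refine exists_congr fun i => ?_
    rw [mul_lt_mul_iff_right₀ (norm_pos_iff.mpr hρ.ne')]
  rw [← h, measureReal_def, measureReal_def,
    Measure.addHaar_preimage_smul volume hρ.ne', measure_preimage_add, finrank_euclideanSpace_fin, ENNReal.toReal_mul, ENNReal.toReal_ofReal (abs_nonneg _),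
    abs_of_pos (by positivity)]
  field_simp

theorem volume_real_ballUnion_linearIsometryEquiv
    (O : EuclideanSpace ℝ (Fin d) ≃ₗᵢ[ℝ] EuclideanSpace ℝ (Fin d))
    (z : ι → EuclideanSpace ℝ (Fin d)) :
    volume.real (ballUnion 0 fun i => O (z i)) = volume.real (ballUnion 0 z) := by
  have h : O ⁻¹' (ballUnion 0 fun i => O (z i)) = ballUnion 0 z := by
    ext w
    simp [mem_ballUnion]
  rw [← h, measureReal_def, measureReal_def, O.measurePreserving.measure_preimage
    (isOpen_ballUnion _ _).measurableSet.nullMeasurableSet]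

theorem finrank_pi_euclideanSpace (k d : ℕ) :
    Module.finrank ℝ (Fin k → EuclideanSpace ℝ (Fin d)) = d * k := by
  rw [Module.finrank_pi_fintype]
  simp [mul_comm]

/-- For points with ball union of volume at most `s`, the distances to `x` are bounded. -/
theorem dist_pow_mul_le_of_volume_ballUnion_le [NeZero d] [Finite ι] {x : EuclideanSpace ℝ (Fin d)}
    {z : ι → EuclideanSpace ℝ (Fin d)} {s : ℝ} (h : volume.real (ballUnion x z) ≤ s) (i : ι) :
    dist (z i) x ^ d * unitBallVolume d ≤ s := by
  rw [← volume_real_ball (z i) dist_nonneg]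
  exact (measureReal_ball_le_ballUnion volume x z i).trans h

theorem exists_pow_mul_unitBallVolume_eq [NeZero d] {s : ℝ} (hs : 0 < s) :
    ∃ r, 0 < r ∧ r ^ d * unitBallVolume d = s := by
  have hv := unitBallVolume_pos (d := d)
  refine ⟨(s / unitBallVolume d) ^ ((d : ℝ)⁻¹), by positivity, ?_⟩
  rw [Real.rpow_inv_natCast_pow (by positivity) (NeZero.ne d)]
  field_simp

theorem mem_closedBall_of_volume_ballUnion_le [NeZero d] [Finite ι]
    {x : EuclideanSpace ℝ (Fin d)} {z : ι → EuclideanSpace ℝ (Fin d)} {s r : ℝ}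
    (h : volume.real (ballUnion x z) ≤ s) (hr : 0 ≤ r) (hrs : s ≤ r ^ d * unitBallVolume d)
    (i : ι) : z i ∈ Metric.closedBall x r := by
  have h1 := (dist_pow_mul_le_of_volume_ballUnion_le h i).trans hrs
  exact le_of_pow_le_pow_left₀ (NeZero.ne d) hr (le_of_mul_le_mul_right h1 unitBallVolume_pos)

theorem measurableSet_volume_ballUnion_le [Countable ι] (x : EuclideanSpace ℝ (Fin d)) (s : ℝ) :
    MeasurableSet {z : ι → EuclideanSpace ℝ (Fin d) | volume.real (ballUnion x z) ≤ s} :=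
  measurableSet_le (measurable_measureReal_ballUnion volume x) measurable_const

/-- Each ball is part of the union, so all points stay in a fixed ball about `x`. Finiteness is
needed because `volume.real` is monotone only below sets of finite volume. -/
theorem volume_setOf_volume_ballUnion_le_ne_top [NeZero d] [Fintype ι]
    (x : EuclideanSpace ℝ (Fin d)) (s : ℝ) :
    volume {z : ι → EuclideanSpace ℝ (Fin d) | volume.real (ballUnion x z) ≤ s} ≠ ⊤ := by
  obtain ⟨r, hr, hrs⟩ := exists_pow_mul_unitBallVolume_eq (d := d) (s := |s| + 1) (by positivity)
  refine ((measure_mono (t := Set.univ.pi fun _ => Metric.closedBall x r) ?_).trans_lt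
    (isCompact_univ_pi fun _ => isCompact_closedBall _ _).measure_lt_top).ne
  intro z hz i _
  refine mem_closedBall_of_volume_ballUnion_le hz hr.le ?_ i
  rw [hrs]
  linarith [le_abs_self s]

/-- The volume of the set of `k`-tuples whose ball union has volume at most `1`. -/
noncomputable def smallUnionVolume (d k : ℕ) : ℝ :=
  volume.real {z : Fin k → EuclideanSpace ℝ (Fin d) | volume.real (ballUnion 0 z) ≤ 1}

/-- A dilation by `ρ` with `ρ ^ d = s` scales ball unions by `s` and volume on `k`-tuples by `ρ ^ (d
* k) = s ^ k`. -/
theorem volume_real_setOf_volume_ballUnion_le [NeZero d] (k : ℕ) (x : EuclideanSpace ℝ (Fin d))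
    {s : ℝ} (hs : 0 < s) :
    volume.real {z : Fin k → EuclideanSpace ℝ (Fin d) | volume.real (ballUnion x z) ≤ s} =
      s ^ k * smallUnionVolume d k := by
  obtain ⟨ρ, hρ, hρs⟩ : ∃ ρ : ℝ, 0 < ρ ∧ ρ ^ d = s :=
    ⟨s ^ ((d : ℝ)⁻¹), by positivity, Real.rpow_inv_natCast_pow hs.le (NeZero.ne d)⟩
  have h : (fun z => ρ • z) ⁻¹' ((fun z => (fun _ => x) + z) ⁻¹'
      {z : Fin k → EuclideanSpace ℝ (Fin d) | volume.real (ballUnion x z) ≤ s}) =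
      {z | volume.real (ballUnion 0 z) ≤ 1} := by
    ext z
    have : ((fun _ => x) + ρ • z) = fun i => x + ρ • z i := rfl
    simp only [Set.mem_preimage, Set.mem_ofPred_eq]
    rw [this, volume_real_ballUnion_dilation x hρ, hρs]
    constructor
    · intro h; nlinarith
    · intro h; nlinarith
  rw [smallUnionVolume, ← h, measureReal_def, measureReal_def,
    Measure.addHaar_preimage_smul volume hρ.ne', measure_preimage_add,
    finrank_pi_euclideanSpace, ENNReal.toReal_mul, ENNReal.toReal_ofReal (abs_nonneg _),
    abs_of_pos (by positivity), pow_mul, hρs]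
  field_simp

end

/-! ### Comparison of product measures. -/

section

variable {X : Type*} [MeasurableSpace X]

/-- Domination passes to powers of measures. This is why closeness of two measures is expressed
below through a common minorant. -/
theorem measure_pi_mono {γ α : Measure X} [IsFiniteMeasure γ] [IsFiniteMeasure α] (h : γ ≤ α)
    (k : ℕ) : Measure.pi (fun _ : Fin k => γ) ≤ Measure.pi fun _ : Fin k => α := by
  induction k with
  | zero => rw [Measure.pi_of_empty, Measure.pi_of_empty]
  | succ k ih =>
    rw [← ((measurePreserving_piFinSuccAbove (fun _ : Fin (k + 1) => γ) 0).symm).map_eq,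
      ← ((measurePreserving_piFinSuccAbove (fun _ : Fin (k + 1) => α) 0).symm).map_eq]
    exact Measure.map_mono (Measure.prod_mono h ih) (MeasurableEquiv.measurable _)

/-- The excess of `α` over `γ` on `A` is at most the total excess, and `γ ≤ β` on `A`. -/
theorem measureReal_le_add_of_le {γ α β : Measure X} [IsFiniteMeasure γ] [IsFiniteMeasure α]
    [IsFiniteMeasure β] (hα : γ ≤ α) (hβ : γ ≤ β) {A : Set X} (hA : MeasurableSet A) :
    α.real A ≤ β.real A + (α.real Set.univ - γ.real Set.univ) := by
  have h1 := measureReal_add_measureReal_compl (μ := α) hA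
  have h2 := measureReal_add_measureReal_compl (μ := γ) hA
  have h3 : γ.real Aᶜ ≤ α.real Aᶜ := ENNReal.toReal_mono (measure_ne_top _ _) (hα _)
  have h4 : γ.real A ≤ β.real A := ENNReal.toReal_mono (measure_ne_top _ _) (hβ _)
  linarith

/-- Two finite measures with a common lower bound of mass at least `l` and masses at most `u`
differ by at most `u ^ k - l ^ k` on products. -/
theorem abs_measureReal_pi_sub_le {γ α β : Measure X} [IsFiniteMeasure γ] [IsFiniteMeasure α]
    [IsFiniteMeasure β] (hα : γ ≤ α) (hβ : γ ≤ β) {l u : ℝ} (hl : 0 ≤ l)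
    (hγl : l ≤ γ.real Set.univ) (hαu : α.real Set.univ ≤ u) (hβu : β.real Set.univ ≤ u) {k : ℕ}
    {A : Set (Fin k → X)} (hA : MeasurableSet A) :
    |(Measure.pi fun _ : Fin k => α).real A - (Measure.pi fun _ : Fin k => β).real A| ≤
      u ^ k - l ^ k := by
  have hpi : ∀ (ρ : Measure X) [IsFiniteMeasure ρ],
      (Measure.pi fun _ : Fin k => ρ).real Set.univ = ρ.real Set.univ ^ k := fun ρ _ => by
    rw [measureReal_def, Measure.pi_univ, Finset.prod_const, Finset.card_univ, Fintype.card_fin,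
      ENNReal.toReal_pow, measureReal_def]
  have h1 := measureReal_le_add_of_le (measure_pi_mono hα k) (measure_pi_mono hβ k) hA
  have h2 := measureReal_le_add_of_le (measure_pi_mono hβ k) (measure_pi_mono hα k) hA
  rw [hpi, hpi] at h1 h2
  have h3 : l ^ k ≤ γ.real Set.univ ^ k := pow_le_pow_left₀ hl hγl k
  have h4 : α.real Set.univ ^ k ≤ u ^ k := pow_le_pow_left₀ measureReal_nonneg hαu k
  have h5 : β.real Set.univ ^ k ≤ u ^ k := pow_le_pow_left₀ measureReal_nonneg hβu k
  rw [abs_le]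
  constructor <;> linarith

end

/-! ### Lebesgue points of the density. -/

section

variable {d : ℕ}

/-- Near `x`, the measure `μ` is close in total variation to `a` times Lebesgue measure: on small
balls about `x`, the two have a common lower bound of almost full mass. -/
def HasLocalDensityAt (μ : Measure (EuclideanSpace ℝ (Fin d))) (x : EuclideanSpace ℝ (Fin d))
    (a : ℝ) : Prop :=
  ∀ η > 0, ∃ δ > 0, ∀ r > 0, r ≤ δ → ∃ γ : Measure (EuclideanSpace ℝ (Fin d)),
    γ ≤ μ.restrict (Metric.closedBall x r) ∧
    γ ≤ (ENNReal.ofReal a • volume).restrict (Metric.closedBall x r) ∧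
    (a - η) * volume.real (Metric.closedBall x r) ≤ γ.real Set.univ ∧
    μ.real (Metric.closedBall x r) ≤ (a + η) * volume.real (Metric.closedBall x r)

/-- At a Lebesgue point of the density `f` with `0 < f x < ∞`, take `min f (f x)` as the density of
the minorant: the integral of `|f - f x|` over a small ball bounds every loss of mass. -/
theorem ae_hasLocalDensityAt {μ : Measure (EuclideanSpace ℝ (Fin d))} [IsFiniteMeasure μ]
    (hμ : μ ≪ volume) : ∀ᵐ x ∂μ, ∃ a > 0, HasLocalDensityAt μ x a := by
  set f : EuclideanSpace ℝ (Fin d) → ℝ := fun y => (μ.rnDeriv volume y).toReal with hf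
  have hfi : Integrable f volume := Measure.integrable_toReal_rnDeriv
  have hf0 : ∀ y, 0 ≤ f y := fun y => ENNReal.toReal_nonneg
  have hμf : μ = volume.withDensity fun y => ENNReal.ofReal (f y) := by
    conv_lhs => rw [← Measure.withDensity_rnDeriv_eq μ volume hμ]
    refine withDensity_congr_ae ?_
    filter_upwards [Measure.rnDeriv_lt_top μ volume] with y hy
    exact (ENNReal.ofReal_toReal hy.ne).symm
  filter_upwards [Measure.rnDeriv_pos hμ, hμ (Measure.rnDeriv_lt_top μ volume),
    hμ (IsUnifLocDoublingMeasure.ae_tendsto_average_norm_sub volume hfi.locallyIntegrable 1)]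
    with x hx0 hxt hx
  refine ⟨f x, ENNReal.toReal_pos hx0.ne' hxt.ne, fun η hη => ?_⟩
  have hlim := hx (fun _ : ℝ => x) id (l := 𝓝[>] 0) tendsto_id (by
    filter_upwards [self_mem_nhdsWithin] with r hr
    simpa using (le_of_lt hr : (0 : ℝ) ≤ r))
  obtain ⟨δ, hδ, hδ'⟩ := mem_nhdsGT_iff_exists_Ioc_subset.mp (hlim.eventually_lt_const hη)
  refine ⟨δ, hδ, fun r hr hrδ => ?_⟩
  set B := Metric.closedBall x r
  have hB : MeasurableSet B := Metric.isClosed_closedBall.measurableSet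
  have hBt : volume B ≠ ⊤ := (isCompact_closedBall x r).measure_lt_top.ne
  have hBp : 0 < volume.real B :=
    ENNReal.toReal_pos (Metric.measure_closedBall_pos _ _ hr).ne' hBt
  have hdev : ∫ y in B, |f y - f x| ≤ η * volume.real B := by
    have h1 : ⨍ y in B, ‖f y - f x‖ < η := hδ' ⟨hr, hrδ⟩
    rw [setAverage_eq, smul_eq_mul, inv_mul_lt_iff₀ hBp] at h1
    simpa only [Real.norm_eq_abs, mul_comm] using h1.le
  have hfB : IntegrableOn f B := hfi.integrableOn
  have hcB : IntegrableOn (fun _ => f x) B := integrableOn_const hBt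
  have hdi : IntegrableOn (fun y => |f y - f x|) B := (hfB.sub hcB).abs
  have hconst : ∫ _ in B, f x = f x * volume.real B := by
    rw [setIntegral_const, smul_eq_mul, mul_comm]
  have hmin : IntegrableOn (fun y => min (f y) (f x)) B := hfB.inf hcB
  refine ⟨(volume.restrict B).withDensity fun y => ENNReal.ofReal (min (f y) (f x)), ?_, ?_, ?_, ?_⟩
  · rw [hμf, restrict_withDensity hB]
    exact withDensity_mono (ae_of_all _ fun y => ENNReal.ofReal_le_ofReal (min_le_left _ _))
  · rw [Measure.restrict_smul, ← withDensity_const]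
    exact withDensity_mono (ae_of_all _ fun y => ENNReal.ofReal_le_ofReal (min_le_right _ _))
  · rw [measureReal_def (μ := Measure.withDensity _ _), withDensity_apply _ MeasurableSet.univ, Measure.restrict_univ,
      ← ofReal_integral_eq_lintegral_ofReal hmin
        (ae_of_all _ fun y => le_min (hf0 y) (hf0 x)),
      ENNReal.toReal_ofReal (integral_nonneg fun y => le_min (hf0 y) (hf0 x))]
    have h2 : ∫ y in B, (f x - |f y - f x|) ≤ ∫ y in B, min (f y) (f x) := by
      refine integral_mono (hcB.sub hdi) hmin fun y => ?_
      refine le_min ?_ ?_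
      · have := neg_abs_le (f y - f x)
        dsimp only; linarith
      · have := abs_nonneg (f y - f x)
        dsimp only; linarith
    rw [integral_sub hcB hdi, hconst] at h2
    linarith
  · rw [hμf, measureReal_def, withDensity_apply _ hB, ← ofReal_integral_eq_lintegral_ofReal hfB
        (ae_of_all _ hf0), ENNReal.toReal_ofReal (integral_nonneg hf0)]
    have h2 : ∫ y in B, f y ≤ ∫ y in B, (f x + |f y - f x|) := by
      refine integral_mono hfB (hcB.add hdi) fun y => ?_
      have := le_abs_self (f y - f x)
      dsimp only; linarith
    rw [integral_add hcB hdi, hconst] at h2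
    linarith

variable {μ : Measure (EuclideanSpace ℝ (Fin d))} [IsFiniteMeasure μ]
  {x : EuclideanSpace ℝ (Fin d)} {a : ℝ}

instance sigmaFinite_ofReal_smul_volume (a : ℝ) :
    SigmaFinite (ENNReal.ofReal a • (volume : Measure (EuclideanSpace ℝ (Fin d)))) :=
  inferInstanceAs (SigmaFinite (a.toNNReal • (volume : Measure (EuclideanSpace ℝ (Fin d)))))

theorem pi_ofReal_smul_volume (k : ℕ) (ha : 0 ≤ a) (A : Set (Fin k → EuclideanSpace ℝ (Fin d))) :
    (Measure.pi fun _ : Fin k => ENNReal.ofReal a • (volume :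
      Measure (EuclideanSpace ℝ (Fin d)))).real A = a ^ k * volume.real A := by
  have : (Measure.pi fun _ : Fin k => ENNReal.ofReal a • (volume :
      Measure (EuclideanSpace ℝ (Fin d)))) = ENNReal.ofReal a ^ k • volume := by
    refine Measure.pi_eq fun s hs => ?_
    simp only [Measure.smul_apply, smul_eq_mul, volume_pi, Measure.pi_pi, Finset.prod_mul_distrib,
      Finset.prod_const, Finset.card_univ, Fintype.card_fin]
  rw [this, measureReal_ennreal_smul_apply, ENNReal.toReal_pow, ENNReal.toReal_ofReal ha]

/-- Tuples in `A` have all entries in the ball, so both measures may be restricted to it, where they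
share a minorant. The condition `η ≤ a` keeps its guaranteed mass nonnegative. -/
theorem HasLocalDensityAt.abs_measureReal_pi_sub_le (h : HasLocalDensityAt μ x a) {η : ℝ}
    (hη : 0 < η) (hηa : η ≤ a) : ∃ δ > 0, ∀ r > 0, r ≤ δ → ∀ (k : ℕ)
      (A : Set (Fin k → EuclideanSpace ℝ (Fin d))), MeasurableSet A →
      (∀ z ∈ A, ∀ i, z i ∈ Metric.closedBall x r) →
      |(Measure.pi fun _ : Fin k => μ).real A - a ^ k * volume.real A| ≤
        ((a + η) ^ k - (a - η) ^ k) * volume.real (Metric.closedBall x r) ^ k := by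
  obtain ⟨δ, hδ, H⟩ := h η hη
  refine ⟨δ, hδ, fun r hr hrδ k A hA hAr => ?_⟩
  obtain ⟨γ, h1, h2, h3, h4⟩ := H r hr hrδ
  have ha : 0 ≤ a := hη.le.trans hηa
  set B := Metric.closedBall x r
  have hBt : volume B ≠ ⊤ := (isCompact_closedBall x r).measure_lt_top.ne
  have hsub : A ⊆ Set.univ.pi fun _ => B := fun z hz i _ => hAr z hz i
  have f1 : IsFiniteMeasure ((ENNReal.ofReal a • volume).restrict B) :=
    ⟨by simpa using ENNReal.mul_lt_top ENNReal.ofReal_lt_top hBt.lt_top⟩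
  have f2 : IsFiniteMeasure γ := isFiniteMeasure_of_le _ h1
  have hmain := _root_.abs_measureReal_pi_sub_le h1 h2 (l := (a - η) * volume.real B)
    (u := (a + η) * volume.real B) (k := k)
    (mul_nonneg (by linarith) measureReal_nonneg) h3 (by simpa using h4) (by
      rw [measureReal_restrict_apply_univ, measureReal_ennreal_smul_apply,
        ENNReal.toReal_ofReal ha]
      gcongr
      linarith) hA
  rw [← Measure.restrict_pi_pi (fun _ : Fin k => μ), ← Measure.restrict_pi_pi
    (fun _ : Fin k => ENNReal.ofReal a • volume), measureReal_restrict_apply hA,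
    measureReal_restrict_apply hA, Set.inter_eq_self_of_subset_left hsub,
    pi_ofReal_smul_volume k ha] at hmain
  refine hmain.trans_eq ?_
  rw [mul_pow, mul_pow]; ring

theorem HasLocalDensityAt.abs_measureReal_sub_le (h : HasLocalDensityAt μ x a) {η : ℝ}
    (hη : 0 < η) (hηa : η ≤ a) : ∃ δ > 0, ∀ r > 0, r ≤ δ →
      ∀ A : Set (EuclideanSpace ℝ (Fin d)), MeasurableSet A → A ⊆ Metric.closedBall x r →
      |μ.real A - a * volume.real A| ≤ 2 * η * volume.real (Metric.closedBall x r) := by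
  obtain ⟨δ, hδ, H⟩ := h.abs_measureReal_pi_sub_le hη hηa
  refine ⟨δ, hδ, fun r hr hrδ A hA hAr => ?_⟩
  have := H r hr hrδ 1 (Set.univ.pi fun _ => A) (MeasurableSet.univ_pi fun _ => hA)
    (fun z hz i => hAr (hz i trivial))
  rw [measureReal_def, measureReal_def, Measure.pi_pi, volume_pi, Measure.pi_pi] at this
  simp only [Finset.univ_unique, Finset.prod_const, Finset.card_singleton, pow_one] at this
  refine this.trans_eq ?_
  ring

end

/-! ### Probability of a ball union of small mass. -/

section

variable {d : ℕ} [NeZero d] {μ : Measure (EuclideanSpace ℝ (Fin d))} [IsFiniteMeasure μ]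
  {x : EuclideanSpace ℝ (Fin d)} {a : ℝ}

/-- If the ball about `z` with `x` on its boundary has small mass, then it has small volume. -/
theorem HasLocalDensityAt.dist_pow_mul_le (h : HasLocalDensityAt μ x a) (ha : 0 < a) :
    ∃ t₀ > 0, ∀ t < t₀, ∀ z, μ.real (Metric.ball z (dist z x)) ≤ t →
      dist z x ^ d * unitBallVolume d ≤ 2 * t / a := by
  have hv := unitBallVolume_pos (d := d)
  -- The ball about `z` lies in the ball about `x` of twice the radius, whose volume is `2 ^ d`
  -- times as large. This `η` makes the error exactly `a / 2` times the volume of the ball about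
  -- `z`.
  obtain ⟨δ, hδ, H⟩ := h.abs_measureReal_sub_le (η := a / (4 * 2 ^ d)) (by positivity)
    (div_le_self ha.le (by have := one_le_pow₀ (one_le_two (α := ℝ)) (n := d); linarith))
  have key : ∀ z, 0 < dist z x → dist z x ≤ δ / 2 →
      a / 2 * (dist z x ^ d * unitBallVolume d) ≤ μ.real (Metric.ball z (dist z x)) := by
    intro z hz hzδ
    have h1 := H (2 * dist z x) (by positivity) (by linarith) (Metric.ball z (dist z x))
      Metric.isOpen_ball.measurableSet (fun w hw => by
        rw [Metric.mem_ball] at hw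
        rw [Metric.mem_closedBall]
        linarith [dist_triangle w z x])
    rw [volume_real_ball z dist_nonneg, volume_real_closedBall x (by positivity)] at h1
    have h2 : 2 * (a / (4 * 2 ^ d)) * ((2 * dist z x) ^ d * unitBallVolume d) =
        a / 2 * (dist z x ^ d * unitBallVolume d) := by
      rw [mul_pow]; field_simp; ring
    rw [h2] at h1
    have := (abs_le.mp h1).1
    linarith
  refine ⟨a / 2 * ((δ / 2) ^ d * unitBallVolume d), by positivity, fun t ht z hz => ?_⟩
  rw [le_div_iff₀ ha]
  rcases (dist_nonneg (x := z) (y := x)).eq_or_lt with h0 | h0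
  · rw [← h0, zero_pow (NeZero.ne d)]
    have := measureReal_nonneg.trans hz
    linarith
  rcases le_or_gt (dist z x) (δ / 2) with hle | hgt
  · linarith [key z h0 hle]
  -- For distant `z`, slide the centre towards `x` to distance `δ / 2`. The smaller ball lies inside
  -- the original one and already has mass at least the threshold `t₀`.
  · exfalso
    set s := δ / 2 / dist z x with hs
    have hs0 : 0 < s := by positivity
    have hs1 : s ≤ 1 := by rw [hs, div_le_one h0]; exact hgt.le
    have hsd : s * dist z x = δ / 2 := by rw [hs]; field_simp
    set z' := x + s • (z - x) with hz'
    have hd1 : dist z' x = δ / 2 := by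
      rw [hz', dist_self_add_left, norm_smul, Real.norm_of_nonneg hs0.le, ← dist_eq_norm, hsd]
    have hd2 : dist z' z = dist z x - δ / 2 := by
      have : z' - z = (1 - s) • (x - z) := by rw [hz']; module
      rw [dist_eq_norm, this, norm_smul, Real.norm_of_nonneg (by linarith), ← dist_eq_norm,
        dist_comm x z, sub_mul, hsd, one_mul]
    have hsub : Metric.ball z' (dist z' x) ⊆ Metric.ball z (dist z x) := by
      refine Metric.ball_subset_ball' ?_
      rw [hd1, hd2]; linarith
    have h3 := key z' (by rw [hd1]; positivity) hd1.le
    rw [hd1] at h3 hsub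
    have h4 : μ.real (Metric.ball z' (δ / 2)) ≤ μ.real (Metric.ball z (dist z x)) :=
      measureReal_mono hsub
    linarith

theorem ballUnion_subset_closedBall {d : ℕ} {ι : Type*} {x : EuclideanSpace ℝ (Fin d)}
    {z : ι → EuclideanSpace ℝ (Fin d)} {r : ℝ}
    (h : ∀ i, z i ∈ Metric.closedBall x r) : ballUnion x z ⊆ Metric.closedBall x (2 * r) := by
  intro w hw
  obtain ⟨i, hi⟩ := mem_ballUnion.mp hw
  have := h i
  rw [Metric.mem_closedBall] at this ⊢
  linarith [dist_triangle w (z i) x]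

/-- Mass at most `t` confines the points to a ball about `x` of volume `2t / a`. There the `μ`-mass
of the union differs from `a` times its volume by at most `θt`, with `θ = 4 * 2 ^ d / a * η`, since
the union lies in the doubled ball. The event is thus sandwiched between volume conditions at levels
`t (1 ∓ θ) / a`; the other error term compares the product measures. -/
theorem HasLocalDensityAt.eventually_bounds (h : HasLocalDensityAt μ x a) (ha : 0 < a) (k : ℕ)
    {η : ℝ} (hη : 0 < η) (hηa : η ≤ a) (hθ : 4 * 2 ^ d / a * η < 1) :
    ∀ᶠ t in 𝓝[>] (0 : ℝ),
      (1 - 4 * 2 ^ d / a * η) ^ k * smallUnionVolume d k -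
          ((a + η) ^ k - (a - η) ^ k) * (2 / a) ^ k ≤
        (Measure.pi fun _ : Fin k => μ).real {z | μ.real (ballUnion x z) ≤ t} / t ^ k ∧
      (Measure.pi fun _ : Fin k => μ).real {z | μ.real (ballUnion x z) ≤ t} / t ^ k ≤
        (1 + 4 * 2 ^ d / a * η) ^ k * smallUnionVolume d k +
          ((a + η) ^ k - (a - η) ^ k) * (2 / a) ^ k := by
  have hv := unitBallVolume_pos (d := d)
  obtain ⟨t₀, ht₀, H₀⟩ := h.dist_pow_mul_le ha
  obtain ⟨δ₁, hδ₁, H₁⟩ := h.abs_measureReal_sub_le hη hηa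
  obtain ⟨δ₂, hδ₂, H₂⟩ := h.abs_measureReal_pi_sub_le hη hηa
  set θ := 4 * 2 ^ d / a * η with hθdef
  have hθ0 : 0 < θ := by positivity
  set δ := min (δ₁ / 2) δ₂ with hδdef
  have hδ : 0 < δ := by positivity
  set t₁ := min t₀ (δ ^ d * unitBallVolume d * a / 2) with ht₁def
  have ht₁ : 0 < t₁ := by positivity
  filter_upwards [Ioo_mem_nhdsGT ht₁] with t ht
  have ht0 : 0 < t := ht.1
  have htt₀ : t < t₀ := ht.2.trans_le (min_le_left _ _)
  obtain ⟨r, hr, hrt⟩ := exists_pow_mul_unitBallVolume_eq (d := d) (s := 2 * t / a) (by positivity)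
  have hrδ : r ≤ δ := by
    have h1 : t < δ ^ d * unitBallVolume d * a / 2 := ht.2.trans_le (min_le_right _ _)
    have h2 : r ^ d * unitBallVolume d ≤ δ ^ d * unitBallVolume d := by
      rw [hrt, div_le_iff₀ ha]; linarith
    exact le_of_pow_le_pow_left₀ (NeZero.ne d) hδ.le (le_of_mul_le_mul_right h2 hv)
  have hrδ₁ : 2 * r ≤ δ₁ := by linarith [min_le_left (δ₁ / 2) δ₂]
  have hrδ₂ : r ≤ δ₂ := hrδ.trans (min_le_right _ _)
  have hcmp : ∀ z : Fin k → EuclideanSpace ℝ (Fin d), (∀ i, z i ∈ Metric.closedBall x r) →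
      |μ.real (ballUnion x z) - a * volume.real (ballUnion x z)| ≤ θ * t := by
    intro z hz
    refine (H₁ (2 * r) (by positivity) hrδ₁ _ (isOpen_ballUnion x z).measurableSet
      (ballUnion_subset_closedBall hz)).trans_eq ?_
    rw [volume_real_closedBall x (by positivity), mul_pow, mul_assoc (2 ^ d), hrt, hθdef]
    field_simp
    ring
  set G : ℝ → Set (Fin k → EuclideanSpace ℝ (Fin d)) := fun s =>
    {z | volume.real (ballUnion x z) ≤ s} with hG
  have hGvol : ∀ s, 0 < s → a ^ k * volume.real (G (t * s / a)) =
      t ^ k * (s ^ k * smallUnionVolume d k) := by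
    intro s hs
    rw [hG, volume_real_setOf_volume_ballUnion_le k x (by positivity)]
    rw [div_pow, mul_pow]
    field_simp
  have hGm : ∀ s, MeasurableSet (G s) := fun s => measurableSet_volume_ballUnion_le x s
  have hballr : volume.real (Metric.closedBall x r) = 2 * t / a := by
    rw [volume_real_closedBall x hr.le, hrt]
  constructor
  · have hsub : ∀ z ∈ G (t * (1 - θ) / a), ∀ i, z i ∈ Metric.closedBall x r := fun z hz i => by
      refine mem_closedBall_of_volume_ballUnion_le hz hr.le ?_ i
      rw [hrt]
      exact div_le_div_of_nonneg_right (by nlinarith) ha.le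
    have h1 : G (t * (1 - θ) / a) ⊆ {z | μ.real (ballUnion x z) ≤ t} := by
      intro z hz
      have h2 := (abs_le.mp (hcmp z (hsub z hz))).2
      have h3 : volume.real (ballUnion x z) ≤ t * (1 - θ) / a := hz
      rw [le_div_iff₀ ha] at h3
      rw [Set.mem_ofPred_eq]
      linarith
    have h4 := (abs_le.mp (H₂ r hr hrδ₂ k _ (hGm _) hsub)).1
    rw [hGvol _ (by linarith), hballr] at h4
    have h5 : (Measure.pi fun _ : Fin k => μ).real (G (t * (1 - θ) / a)) ≤
        (Measure.pi fun _ : Fin k => μ).real {z | μ.real (ballUnion x z) ≤ t} :=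
      measureReal_mono h1
    rw [le_div_iff₀ (by positivity)]
    have h6 : (2 * t / a) ^ k = (2 / a) ^ k * t ^ k := by rw [← mul_pow]; ring
    rw [h6] at h4
    linarith
  · set H := {z : Fin k → EuclideanSpace ℝ (Fin d) | μ.real (ballUnion x z) ≤ t}
    have hHr : ∀ z ∈ H, ∀ i, z i ∈ Metric.closedBall x r := fun z hz i => by
      have h2 := H₀ t htt₀ (z i) ((measureReal_ball_le_ballUnion μ x z i).trans hz)
      rw [← hrt] at h2
      exact le_of_pow_le_pow_left₀ (NeZero.ne d) hr.le (le_of_mul_le_mul_right h2 hv)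
    have hHm : MeasurableSet H :=
      measurableSet_le (measurable_measureReal_ballUnion μ x) measurable_const
    have h1 : H ⊆ G (t * (1 + θ) / a) := by
      intro z hz
      have h2 := (abs_le.mp (hcmp z (hHr z hz))).1
      have h3 : μ.real (ballUnion x z) ≤ t := hz
      change volume.real (ballUnion x z) ≤ t * (1 + θ) / a
      rw [le_div_iff₀ ha]
      linarith
    have h4 := (abs_le.mp (H₂ r hr hrδ₂ k _ hHm hHr)).2
    have h5 : volume.real H ≤ volume.real (G (t * (1 + θ) / a)) :=
      measureReal_mono h1 (volume_setOf_volume_ballUnion_le_ne_top x _)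
    have h7 : a ^ k * volume.real H ≤ a ^ k * volume.real (G (t * (1 + θ) / a)) := by gcongr
    rw [hGvol _ (by linarith)] at h7
    rw [hballr] at h4
    rw [div_le_iff₀ (by positivity)]
    have h6 : (2 * t / a) ^ k = (2 / a) ^ k * t ^ k := by rw [← mul_pow]; ring
    rw [h6] at h4
    linarith

/-- The probability that the ball union of `k` random points has mass at most `t` is asymptotic to
`smallUnionVolume d k * t ^ k` as `t → 0`. -/
theorem HasLocalDensityAt.tendsto_measureReal_div_pow (h : HasLocalDensityAt μ x a) (ha : 0 < a)
    (k : ℕ) :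
    Tendsto (fun t : ℝ => (Measure.pi fun _ : Fin k => μ).real
      {z | μ.real (ballUnion x z) ≤ t} / t ^ k) (𝓝[>] 0) (𝓝 (smallUnionVolume d k)) := by
  have hlow : Tendsto (fun η : ℝ => (1 - 4 * 2 ^ d / a * η) ^ k *
      smallUnionVolume d k - ((a + η) ^ k - (a - η) ^ k) * (2 / a) ^ k)
      (𝓝[>] 0) (𝓝 (smallUnionVolume d k)) := by
    refine (Continuous.tendsto' (by fun_prop) 0 _ ?_).mono_left nhdsWithin_le_nhds
    simp
  have hupp : Tendsto (fun η : ℝ => (1 + 4 * 2 ^ d / a * η) ^ k *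
      smallUnionVolume d k + ((a + η) ^ k - (a - η) ^ k) * (2 / a) ^ k)
      (𝓝[>] 0) (𝓝 (smallUnionVolume d k)) := by
    refine (Continuous.tendsto' (by fun_prop) 0 _ ?_).mono_left nhdsWithin_le_nhds
    simp
  have hsmall : ∀ᶠ η in 𝓝[>] (0 : ℝ), 0 < η ∧ η ≤ a ∧ 4 * 2 ^ d / a * η < 1 := by
    have h1 : Tendsto (fun η : ℝ => 4 * 2 ^ d / a * η) (𝓝[>] 0) (𝓝 0) :=
      (Continuous.tendsto' (by fun_prop) 0 _ (by simp)).mono_left nhdsWithin_le_nhds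
    filter_upwards [Ioc_mem_nhdsGT ha, h1.eventually_lt_const one_pos] with η h2 h3
    exact ⟨h2.1, h2.2, h3⟩
  rw [tendsto_order]
  constructor
  · intro b hb
    obtain ⟨η, h1, h2, h3, h4⟩ := ((hlow.eventually_const_lt hb).and hsmall).exists
    filter_upwards [h.eventually_bounds ha k h2 h3 h4] with t ht
    exact h1.trans_le ht.1
  · intro b hb
    obtain ⟨η, h1, h2, h3, h4⟩ := ((hupp.eventually_lt_const hb).and hsmall).exists
    filter_upwards [h.eventually_bounds ha k h2 h3 h4] with t ht
    exact ht.2.trans_lt h1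

end

/-! ### Identification of the limiting constant. -/

section

variable {d : ℕ} [NeZero d]

theorem ball_ae_eq_closedBall (x : EuclideanSpace ℝ (Fin d)) (r : ℝ) :
    (Metric.ball x r : Set _) =ᵐ[volume] (Metric.closedBall x r : Set _) :=
  ae_eq_of_subset_of_measure_ge Metric.ball_subset_closedBall
    (Measure.addHaar_closedBall_eq_addHaar_ball volume x r).le
    Metric.isOpen_ball.measurableSet.nullMeasurableSet
    (isCompact_closedBall x r).measure_lt_top.ne

/-- Open and closed balls differ by null spheres. -/
theorem unionVolumeRatio_mul_unitBallVolume {m : ℕ} (y : Fin m → EuclideanSpace ℝ (Fin d)) :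
    unionVolumeRatio y * unitBallVolume d = volume.real (ballUnion 0
      (Fin.cons (EuclideanSpace.single (0 : Fin d) (1 : ℝ)) y :
        Fin (m + 1) → EuclideanSpace ℝ (Fin d))) := by
  have hv := unitBallVolume_pos (d := d)
  have h : ballUnion 0 (Fin.cons (EuclideanSpace.single (0 : Fin d) (1 : ℝ)) y :
      Fin (m + 1) → EuclideanSpace ℝ (Fin d)) =
      Metric.ball (EuclideanSpace.single (0 : Fin d) (1 : ℝ)) 1 ∪
        ⋃ i, Metric.ball (y i) ‖y i‖ := by
    ext w
    simp [ballUnion, Fin.exists_fin_succ]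
  rw [h, unionVolumeRatio, ← unitBallVolume, div_mul_cancel₀ _ hv.ne']
  exact (measureReal_congr ((ball_ae_eq_closedBall _ _).union
    (Filter.EventuallyEq.countable_iUnion fun i => ball_ae_eq_closedBall _ _))).symm

/-- With all entries but the `i`-th fixed, the slice is a sphere. -/
theorem volume_setOf_norm_eq_norm (k : ℕ) {i j : Fin k} (hij : i ≠ j) :
    volume {z : Fin k → EuclideanSpace ℝ (Fin d) | ‖z i‖ = ‖z j‖} = 0 := by
  obtain ⟨n, rfl⟩ : ∃ n, k = n + 1 := ⟨k - 1, by have := i.pos; omega⟩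
  obtain ⟨l, rfl⟩ := Fin.exists_succAbove_eq hij.symm
  have hmp := (volume_preserving_piFinSuccAbove
    (fun _ : Fin (n + 1) => EuclideanSpace ℝ (Fin d)) i).symm
  rw [← hmp.measure_preimage_equiv, Measure.volume_eq_prod, ← Measure.prod_swap,
    Measure.map_apply measurable_swap, Measure.measure_prod_null]
  · refine ae_of_all _ fun y => ?_
    have : Prod.mk y ⁻¹' (Prod.swap ⁻¹' ((MeasurableEquiv.piFinSuccAbove
        (fun _ : Fin (n + 1) => EuclideanSpace ℝ (Fin d)) i).symm ⁻¹'
          {z | ‖z i‖ = ‖z (i.succAbove l)‖})) = Metric.sphere 0 ‖y l‖ := by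
      ext w
      simp [MeasurableEquiv.piFinSuccAbove_symm_apply, Fin.insertNthEquiv]
    dsimp only
    rw [this]
    exact Measure.addHaar_sphere volume _ _
  · refine measurable_swap (MeasurableEquiv.measurable _ ?_)
    exact measurableSet_eq_fun (by fun_prop) (by fun_prop)
  · exact MeasurableEquiv.measurable _ (measurableSet_eq_fun (by fun_prop) (by fun_prop))

/-- For a permutation-invariant set of tuples, a fixed entry has the largest norm on a fraction
`1 / k` of the set. -/
theorem volume_eq_mul_volume_inter_norm_le (m : ℕ)
    {A : Set (Fin (m + 1) → EuclideanSpace ℝ (Fin d))} (hA : MeasurableSet A)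
    (hperm : ∀ (e : Equiv.Perm (Fin (m + 1))) z, (fun i => z (e i)) ∈ A ↔ z ∈ A) :
    volume A = (m + 1 : ℕ) * volume (A ∩ {z | ∀ j, ‖z j‖ ≤ ‖z 0‖}) := by
  set S : Fin (m + 1) → Set (Fin (m + 1) → EuclideanSpace ℝ (Fin d)) :=
    fun i => A ∩ {z | ∀ j, ‖z j‖ ≤ ‖z i‖} with hS
  have hSm : ∀ i, MeasurableSet (S i) := fun i => by
    refine hA.inter ?_
    rw [Set.ofPred_forall]
    exact MeasurableSet.iInter fun j => measurableSet_le (by fun_prop) (by fun_prop)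
  have hU : A = ⋃ i, S i := by
    ext z
    simp only [hS, Set.mem_iUnion, Set.mem_inter_iff, Set.mem_ofPred_eq]
    constructor
    · intro hz
      obtain ⟨i, hi⟩ := Finite.exists_max fun i => ‖z i‖
      exact ⟨i, hz, hi⟩
    · rintro ⟨i, hz, -⟩
      exact hz
  have hdisj : Pairwise (Function.onFun (AEDisjoint volume) S) := by
    intro i j hij
    refine measure_mono_null (fun z hz => ?_) (volume_setOf_norm_eq_norm (d := d) (m + 1) hij)
    exact le_antisymm (hz.2.2 i) (hz.1.2 j)
  -- The transposition of `0` and `i` preserves volume and carries one piece to the other.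
  have hSi : ∀ i, volume (S i) = volume (S 0) := by
    intro i
    have hmp := volume_measurePreserving_piCongrLeft
      (fun _ : Fin (m + 1) => EuclideanSpace ℝ (Fin d)) (Equiv.swap 0 i)
    rw [← hmp.measure_preimage_equiv (S i)]
    congr 1
    ext z
    have hz : ∀ j, MeasurableEquiv.piCongrLeft (fun _ : Fin (m + 1) => EuclideanSpace ℝ (Fin d))
        (Equiv.swap 0 i) z j = z (Equiv.swap 0 i j) := fun j => by
      have := Equiv.piCongrLeft_apply_apply (fun _ : Fin (m + 1) => EuclideanSpace ℝ (Fin d))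
        (Equiv.swap 0 i) z (Equiv.swap 0 i j)
      rw [Equiv.swap_apply_self] at this
      exact this
    have hz' : MeasurableEquiv.piCongrLeft (fun _ : Fin (m + 1) => EuclideanSpace ℝ (Fin d))
        (Equiv.swap 0 i) z = fun j => z (Equiv.swap 0 i j) := funext hz
    simp only [hS, Set.mem_preimage, Set.mem_inter_iff, Set.mem_ofPred_eq]
    rw [hz', hperm]
    simp only [Equiv.swap_apply_right]
    refine and_congr_right fun _ => ?_
    exact (Equiv.swap 0 i).forall_congr_left (p := fun j => ‖z j‖ ≤ ‖z 0‖) |>.symm.trans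
      (by simp) |>.trans Iff.rfl
  conv_lhs => rw [hU]
  rw [measure_iUnion₀ hdisj fun i => (hSm i).nullMeasurableSet, tsum_fintype,
    Finset.sum_congr rfl fun i _ => hSi i, Finset.sum_const, Finset.card_univ, Fintype.card_fin,
    nsmul_eq_mul]

theorem exists_linearIsometryEquiv_eq {d : ℕ} {e w : EuclideanSpace ℝ (Fin d)} (h : ‖e‖ = ‖w‖) :
    ∃ O : EuclideanSpace ℝ (Fin d) ≃ₗᵢ[ℝ] EuclideanSpace ℝ (Fin d), O e = w :=
  ⟨_, Submodule.reflection_sub h⟩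

/-- Lebesgue measure on a product of unit balls in terms of the uniform distribution. -/
theorem volume_inter_unit_balls {d : ℕ} (m : ℕ) {A : Set (Fin m → EuclideanSpace ℝ (Fin d))}
    (hA : MeasurableSet A) :
    volume (A ∩ {y | ∀ j, ‖y j‖ ≤ 1}) = ENNReal.ofReal (unitBallVolume d ^ m) *
      (Measure.pi fun _ : Fin m => uniformUnitBall d) A := by
  have hset : {y : Fin m → EuclideanSpace ℝ (Fin d) | ∀ j, ‖y j‖ ≤ 1} =
      Set.univ.pi fun _ => Metric.closedBall 0 1 := by
    ext y; simp [Set.mem_pi]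
  have hvol : volume (Metric.closedBall (0 : EuclideanSpace ℝ (Fin d)) 1) =
      ENNReal.ofReal (unitBallVolume d) := by
    rw [unitBallVolume, ofReal_measureReal (isCompact_closedBall _ _).measure_lt_top.ne]
  have hpi : (Measure.pi fun _ : Fin m => uniformUnitBall d) =
      (ENNReal.ofReal (unitBallVolume d) ^ m)⁻¹ • (volume.restrict (Set.univ.pi fun _ =>
        Metric.closedBall (0 : EuclideanSpace ℝ (Fin d)) 1)) := by
    refine Measure.pi_eq fun s hs => ?_
    rw [volume_pi, Measure.restrict_pi_pi, Measure.smul_apply, Measure.pi_pi, smul_eq_mul]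
    simp only [uniformUnitBall, ProbabilityTheory.cond, Measure.smul_apply, smul_eq_mul, hvol,
      Finset.prod_mul_distrib, Finset.prod_const, Finset.card_univ, Fintype.card_fin,
      ENNReal.inv_pow]
  rw [hpi, hset, Measure.smul_apply, smul_eq_mul, Measure.restrict_apply hA, ← mul_assoc,
    ENNReal.ofReal_pow unitBallVolume_pos.le, ENNReal.mul_inv_cancel, one_mul]
  · exact pow_ne_zero _ (ENNReal.ofReal_pos.mpr unitBallVolume_pos).ne'
  · exact ENNReal.pow_ne_top ENNReal.ofReal_ne_top

theorem Measurable.finCons {X Y : Type*} [MeasurableSpace X] [MeasurableSpace Y] {m : ℕ}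
    {f : X → Y} {g : X → Fin m → Y} (hf : Measurable f) (hg : Measurable g) :
    Measurable fun x => (Fin.cons (f x) (g x) : Fin (m + 1) → Y) := by
  refine measurable_pi_iff.mpr fun i => ?_
  refine Fin.cases ?_ (fun j => ?_) i
  · simpa using hf
  · simpa using measurable_pi_iff.mp hg j

theorem measurable_unionVolumeRatio (m : ℕ) :
    Measurable (unionVolumeRatio : (Fin m → EuclideanSpace ℝ (Fin d)) → ℝ) := by
  have h : (unionVolumeRatio : (Fin m → EuclideanSpace ℝ (Fin d)) → ℝ) = fun y =>
      volume.real (ballUnion 0 (Fin.cons (EuclideanSpace.single (0 : Fin d) (1 : ℝ)) y :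
        Fin (m + 1) → EuclideanSpace ℝ (Fin d))) / unitBallVolume d := by
    ext y
    rw [← unionVolumeRatio_mul_unitBallVolume, mul_div_cancel_right₀ _ unitBallVolume_pos.ne']
  rw [h]
  exact ((measurable_measureReal_ballUnion volume 0).comp
    (measurable_const.finCons measurable_id)).div_const _

/-- The volume of the tuples with ball union of volume at most `1` whose first entry is `w` and
has the largest norm. -/
theorem volume_slice (m : ℕ) {w : EuclideanSpace ℝ (Fin d)} (hw : w ≠ 0) :
    volume {y : Fin m → EuclideanSpace ℝ (Fin d) | volume.real (ballUnion 0
      (Fin.cons w y : Fin (m + 1) → EuclideanSpace ℝ (Fin d))) ≤ 1 ∧ ∀ j, ‖y j‖ ≤ ‖w‖} =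
      ENNReal.ofReal ((‖w‖ ^ d * unitBallVolume d) ^ m) *
        (Measure.pi fun _ : Fin m => uniformUnitBall d)
          {y | ‖w‖ ^ d * unitBallVolume d * unionVolumeRatio y ≤ 1} := by
  have hr : 0 < ‖w‖ := norm_pos_iff.mpr hw
  obtain ⟨O, hO⟩ := exists_linearIsometryEquiv_eq (e := EuclideanSpace.single (0 : Fin d) (1 : ℝ))
    (w := ‖w‖⁻¹ • w) (by simp [norm_smul, hr.ne'])
  set T : Set (Fin m → EuclideanSpace ℝ (Fin d)) :=
    {y | volume.real (ballUnion 0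
      (Fin.cons w y : Fin (m + 1) → EuclideanSpace ℝ (Fin d))) ≤ 1 ∧ ∀ j, ‖y j‖ ≤ ‖w‖} with hT
  have hOpi : MeasurePreserving (fun (y : Fin m → EuclideanSpace ℝ (Fin d)) i => O (y i))
      volume volume := volume_preserving_pi fun _ => O.measurePreserving
  -- The tuple is the image of `(e₁, y)` under the isometry `O` followed by dilation by `‖w‖`.
  have hcons : ∀ y : Fin m → EuclideanSpace ℝ (Fin d),
      volume.real (ballUnion 0 (Fin.cons w (‖w‖ • fun i => O (y i)) :
        Fin (m + 1) → EuclideanSpace ℝ (Fin d))) =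
      ‖w‖ ^ d * unitBallVolume d * unionVolumeRatio y := by
    intro y
    have h1 : (Fin.cons w (‖w‖ • fun i => O (y i)) : Fin (m + 1) → EuclideanSpace ℝ (Fin d)) =
        fun i => 0 + ‖w‖ • O ((Fin.cons (EuclideanSpace.single (0 : Fin d) (1 : ℝ)) y :
          Fin (m + 1) → EuclideanSpace ℝ (Fin d)) i) := by
      funext i
      refine Fin.cases ?_ (fun j => ?_) i
      · rw [Fin.cons_zero, Fin.cons_zero, hO, smul_inv_smul₀ hr.ne', zero_add]
      · rw [Fin.cons_succ, Fin.cons_succ, zero_add, Pi.smul_apply]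
    rw [h1, volume_real_ballUnion_dilation 0 hr (fun i => O ((Fin.cons
      (EuclideanSpace.single (0 : Fin d) (1 : ℝ)) y : Fin (m + 1) → EuclideanSpace ℝ (Fin d)) i)),
      volume_real_ballUnion_linearIsometryEquiv, ← unionVolumeRatio_mul_unitBallVolume]
    ring
  have hpre : (fun (y : Fin m → EuclideanSpace ℝ (Fin d)) i => O (y i)) ⁻¹'
      ((fun y => ‖w‖ • y) ⁻¹' T) =
      {y | ‖w‖ ^ d * unitBallVolume d * unionVolumeRatio y ≤ 1} ∩ {y | ∀ j, ‖y j‖ ≤ 1} := by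
    ext y
    simp only [hT, Set.mem_preimage, Set.mem_ofPred_eq, Set.mem_inter_iff]
    rw [hcons]
    refine and_congr_right fun _ => forall_congr' fun j => ?_
    rw [Pi.smul_apply, norm_smul, norm_norm, LinearIsometryEquiv.norm_map]
    exact mul_le_iff_le_one_right hr
  have hTm : MeasurableSet T := by
    have h2 : MeasurableSet {y : Fin m → EuclideanSpace ℝ (Fin d) | ∀ j, ‖y j‖ ≤ ‖w‖} := by
      rw [Set.ofPred_forall]
      exact MeasurableSet.iInter fun j => measurableSet_le (by fun_prop) measurable_const
    exact (measurableSet_le ((measurable_measureReal_ballUnion volume 0).comp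
      (measurable_const.finCons measurable_id)) measurable_const).inter h2
  have hm := volume_inter_unit_balls (d := d) m
    (A := {y | ‖w‖ ^ d * unitBallVolume d * unionVolumeRatio y ≤ 1})
    (measurableSet_le ((measurable_unionVolumeRatio m).const_mul _) measurable_const)
  have hsm : Measurable fun y : Fin m → EuclideanSpace ℝ (Fin d) => ‖w‖ • y := by fun_prop
  rw [← hpre, hOpi.measure_preimage (hsm hTm).nullMeasurableSet,
    Measure.addHaar_preimage_smul volume hr.ne', finrank_pi_euclideanSpace,
    abs_of_pos (by positivity)] at hm
  calc volume T = ENNReal.ofReal (‖w‖ ^ (d * m)) *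
        (ENNReal.ofReal (‖w‖ ^ (d * m))⁻¹ * volume T) := by
        rw [← mul_assoc, ← ENNReal.ofReal_mul (by positivity),
          mul_inv_cancel₀ (by positivity), ENNReal.ofReal_one, one_mul]
    _ = _ := by
        rw [hm, ← mul_assoc, ← ENNReal.ofReal_mul (by positivity), mul_pow, pow_mul]

end

section

variable {d : ℕ} [NeZero d]

/-- In the variable `u = ‖z‖ ^ d * unitBallVolume d`, which carries Lebesgue measure on the
half-line, this is the integral of `u ^ m`. -/
theorem integral_closedBall_norm_pow (m : ℕ) {ρ : ℝ} (hρ : 0 < ρ) :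
    ∫ z in Metric.closedBall (0 : EuclideanSpace ℝ (Fin d)) ρ,
      (‖z‖ ^ d * unitBallVolume d) ^ m =
      (ρ ^ d * unitBallVolume d) ^ (m + 1) / (m + 1) := by
  have hv := unitBallVolume_pos (d := d)
  obtain ⟨n, hn⟩ : ∃ n, d = n + 1 := ⟨d - 1, by have := NeZero.pos d; omega⟩
  have hset : Metric.closedBall (0 : EuclideanSpace ℝ (Fin d)) ρ = norm ⁻¹' Set.Iic ρ := by
    ext z; simp
  have hball : volume.real (Metric.ball (0 : EuclideanSpace ℝ (Fin d)) 1) = unitBallVolume d := by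
    rw [volume_real_ball 0 zero_le_one, one_pow, one_mul]
  rw [← integral_indicator Metric.isClosed_closedBall.measurableSet, hset]
  have h1 : ∀ z : EuclideanSpace ℝ (Fin d), (norm ⁻¹' Set.Iic ρ).indicator
      (fun z : EuclideanSpace ℝ (Fin d) => (‖z‖ ^ d * unitBallVolume d) ^ m) z =
      (fun r : ℝ => (Set.Iic ρ).indicator (fun r => (r ^ d * unitBallVolume d) ^ m) r) ‖z‖ :=
    fun _ => rfl
  simp_rw [h1]
  rw [integral_fun_norm_addHaar volume
    (fun r : ℝ => (Set.Iic ρ).indicator (fun r => (r ^ d * unitBallVolume d) ^ m) r), hball,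
    finrank_euclideanSpace_fin]
  have h2 : ∀ r : ℝ, r ^ (d - 1) • (Set.Iic ρ).indicator
      (fun r => (r ^ d * unitBallVolume d) ^ m) r =
      (Set.Iic ρ).indicator (fun r => unitBallVolume d ^ m * r ^ (n + d * m)) r := fun r => by
    have : d - 1 = n := by omega
    rw [this]
    by_cases hr : r ∈ Set.Iic ρ
    · rw [Set.indicator_of_mem hr, Set.indicator_of_mem hr, smul_eq_mul]
      ring
    · rw [Set.indicator_of_notMem hr, Set.indicator_of_notMem hr, smul_zero]
  simp_rw [h2]
  rw [setIntegral_indicator measurableSet_Iic, Set.Ioi_inter_Iic,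
    ← intervalIntegral.integral_of_le hρ.le, intervalIntegral.integral_const_mul, integral_pow,
    zero_pow (by omega), sub_zero]
  have h3 : n + d * m + 1 = d * (m + 1) := by rw [mul_add]; omega
  have h4 : ((n + d * m : ℕ) : ℝ) + 1 = d * (m + 1) := by exact_mod_cast h3
  have hd : (d : ℝ) ≠ 0 := by exact_mod_cast NeZero.ne d
  rw [h3, h4, nsmul_eq_mul, smul_eq_mul, mul_pow, ← pow_mul]
  field_simp
  ring

theorem lintegral_radial (m : ℕ) {w : ℝ} (hw : 0 < w) :
    ∫⁻ z : EuclideanSpace ℝ (Fin d), {z | ‖z‖ ^ d * unitBallVolume d * w ≤ 1}.indicator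
      (fun z => ENNReal.ofReal ((‖z‖ ^ d * unitBallVolume d) ^ m)) z =
      ENNReal.ofReal (1 / ((m + 1) * w ^ (m + 1))) := by
  have hv := unitBallVolume_pos (d := d)
  obtain ⟨ρ, hρ, hρw⟩ := exists_pow_mul_unitBallVolume_eq (d := d) (s := 1 / w) (by positivity)
  have hset : {z : EuclideanSpace ℝ (Fin d) | ‖z‖ ^ d * unitBallVolume d * w ≤ 1} =
      Metric.closedBall 0 ρ := by
    ext z
    rw [Set.mem_ofPred_eq, ← le_div_iff₀ hw, ← hρw, mul_le_mul_iff_left₀ hv,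
      pow_le_pow_iff_left₀ (norm_nonneg _) hρ.le (NeZero.ne d), mem_closedBall_zero_iff]
  rw [hset, lintegral_indicator Metric.isClosed_closedBall.measurableSet,
    ← ofReal_integral_eq_lintegral_ofReal, integral_closedBall_norm_pow m hρ, hρw]
  · rw [div_pow, one_pow, div_div, mul_comm]
  · exact (Continuous.continuousOn (by fun_prop)).integrableOn_compact (isCompact_closedBall _ _)
  · exact ae_of_all _ fun z => by positivity

/-- Slice by the first entry `w`, apply `volume_slice`, exchange the integrals and integrate over
`w` for fixed `y`. -/
theorem volume_inter_norm_le_first (m : ℕ) :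
    volume ({z : Fin (m + 1) → EuclideanSpace ℝ (Fin d) | volume.real (ballUnion 0 z) ≤ 1} ∩
      {z | ∀ j, ‖z j‖ ≤ ‖z 0‖}) =
      ∫⁻ y : Fin m → EuclideanSpace ℝ (Fin d),
        ENNReal.ofReal (1 / ((m + 1) * unionVolumeRatio y ^ (m + 1)))
        ∂(Measure.pi fun _ => uniformUnitBall d) := by
  set S := {z : Fin (m + 1) → EuclideanSpace ℝ (Fin d) | volume.real (ballUnion 0 z) ≤ 1} ∩
      {z | ∀ j, ‖z j‖ ≤ ‖z 0‖} with hS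
  have hSm : MeasurableSet S := by
    refine (measurableSet_volume_ballUnion_le 0 1).inter ?_
    rw [Set.ofPred_forall]
    exact MeasurableSet.iInter fun j => measurableSet_le (by fun_prop) (by fun_prop)
  have hmp := (volume_preserving_piFinSuccAbove
    (fun _ : Fin (m + 1) => EuclideanSpace ℝ (Fin d)) 0).symm
  rw [← hmp.measure_preimage_equiv S, Measure.volume_eq_prod,
    Measure.prod_apply (MeasurableEquiv.measurable _ hSm)]
  have hslice : ∀ᵐ w : EuclideanSpace ℝ (Fin d),
      volume (Prod.mk w ⁻¹' ((MeasurableEquiv.piFinSuccAbove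
        (fun _ : Fin (m + 1) => EuclideanSpace ℝ (Fin d)) 0).symm ⁻¹' S)) =
      ∫⁻ y : Fin m → EuclideanSpace ℝ (Fin d),
        {w : EuclideanSpace ℝ (Fin d) |
          ‖w‖ ^ d * unitBallVolume d * unionVolumeRatio y ≤ 1}.indicator
          (fun w => ENNReal.ofReal ((‖w‖ ^ d * unitBallVolume d) ^ m)) w
        ∂(Measure.pi fun _ => uniformUnitBall d) := by
    filter_upwards [Measure.ae_ne volume (0 : EuclideanSpace ℝ (Fin d))] with w hw
    have hpre : Prod.mk w ⁻¹' ((MeasurableEquiv.piFinSuccAbove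
        (fun _ : Fin (m + 1) => EuclideanSpace ℝ (Fin d)) 0).symm ⁻¹' S) =
        {y : Fin m → EuclideanSpace ℝ (Fin d) | volume.real (ballUnion 0
          (Fin.cons w y : Fin (m + 1) → EuclideanSpace ℝ (Fin d))) ≤ 1 ∧
          ∀ j, ‖y j‖ ≤ ‖w‖} := by
      ext y
      simp [hS, MeasurableEquiv.piFinSuccAbove_symm_apply, Fin.insertNthEquiv,
        Fin.forall_fin_succ]
    rw [hpre, volume_slice m hw]
    have hind : ∀ y : Fin m → EuclideanSpace ℝ (Fin d),
        {w : EuclideanSpace ℝ (Fin d) |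
          ‖w‖ ^ d * unitBallVolume d * unionVolumeRatio y ≤ 1}.indicator
          (fun w => ENNReal.ofReal ((‖w‖ ^ d * unitBallVolume d) ^ m)) w =
        {y : Fin m → EuclideanSpace ℝ (Fin d) |
          ‖w‖ ^ d * unitBallVolume d * unionVolumeRatio y ≤ 1}.indicator
          (fun _ => ENNReal.ofReal ((‖w‖ ^ d * unitBallVolume d) ^ m)) y := fun y => by
      simp [Set.indicator_apply]
    simp_rw [hind]
    rw [lintegral_indicator_const]
    exact measurableSet_le ((measurable_unionVolumeRatio m).const_mul _) measurable_const
  rw [lintegral_congr_ae hslice, lintegral_lintegral_swap]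
  · refine lintegral_congr fun y => ?_
    exact lintegral_radial m (one_pos.trans_le (one_le_unionVolumeRatio y))
  · have hset : MeasurableSet {q : EuclideanSpace ℝ (Fin d) × (Fin m → EuclideanSpace ℝ (Fin d)) |
        ‖q.1‖ ^ d * unitBallVolume d * unionVolumeRatio q.2 ≤ 1} := by
      refine measurableSet_le (Measurable.mul (by fun_prop)
        ((measurable_unionVolumeRatio m).comp measurable_snd)) measurable_const
    have : Function.uncurry (fun (w : EuclideanSpace ℝ (Fin d))
        (y : Fin m → EuclideanSpace ℝ (Fin d)) => {w : EuclideanSpace ℝ (Fin d) |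
          ‖w‖ ^ d * unitBallVolume d * unionVolumeRatio y ≤ 1}.indicator
          (fun w => ENNReal.ofReal ((‖w‖ ^ d * unitBallVolume d) ^ m)) w) =
        {q : EuclideanSpace ℝ (Fin d) × (Fin m → EuclideanSpace ℝ (Fin d)) |
          ‖q.1‖ ^ d * unitBallVolume d * unionVolumeRatio q.2 ≤ 1}.indicator
          (fun q => ENNReal.ofReal ((‖q.1‖ ^ d * unitBallVolume d) ^ m)) := by
      ext ⟨w, y⟩; simp [Set.indicator_apply]
    rw [this]
    exact (Measurable.indicator (by fun_prop) hset).aemeasurable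

theorem ballUnion_comp_perm {d : ℕ} {ι : Type*} (x : EuclideanSpace ℝ (Fin d)) (e : Equiv.Perm ι)
    (z : ι → EuclideanSpace ℝ (Fin d)) : (ballUnion x fun i => z (e i)) = ballUnion x z :=
  e.surjective.iUnion_comp fun i => Metric.ball (z i) (dist (z i) x)

/-- The limiting moments as volumes of sets of tuples of points. -/
theorem smallUnionVolume_mul_factorial {k : ℕ} (hk : 1 ≤ k) :
    smallUnionVolume d k * k ! = limitMoment d k := by
  obtain ⟨m, rfl⟩ : ∃ m, k = m + 1 := ⟨k - 1, by omega⟩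
  have hW : ∀ y : Fin m → EuclideanSpace ℝ (Fin d), 0 < unionVolumeRatio y := fun y =>
    one_pos.trans_le (one_le_unionVolumeRatio y)
  have h0 : ∀ y : Fin m → EuclideanSpace ℝ (Fin d),
      1 / (((m : ℝ) + 1) * unionVolumeRatio y ^ (m + 1)) =
      ((m + 1 : ℝ) * (m + 1)!)⁻¹ * ((m + 1)! / unionVolumeRatio y ^ (m + 1)) := fun y => by
    have := hW y
    have := Nat.factorial_pos (m + 1)
    field_simp
  have hint : Integrable (fun y : Fin m → EuclideanSpace ℝ (Fin d) =>
      1 / (((m : ℝ) + 1) * unionVolumeRatio y ^ (m + 1)))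
      (Measure.pi fun _ => uniformUnitBall d) := by
    simp_rw [h0]
    exact (integrable_limitMoment d (m + 1)).const_mul _
  have hval : ∫ y : Fin m → EuclideanSpace ℝ (Fin d),
      1 / (((m : ℝ) + 1) * unionVolumeRatio y ^ (m + 1)) ∂(Measure.pi fun _ => uniformUnitBall d) =
      ((m + 1 : ℝ) * (m + 1)!)⁻¹ * limitMoment d (m + 1) := by
    simp_rw [h0]
    rw [integral_const_mul]
    rfl
  -- The factor `m + 1` for the choice of the farthest point cancels the `1 / (m + 1)` of the radial
  -- integral.
  have hvol := volume_eq_mul_volume_inter_norm_le m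
    (measurableSet_volume_ballUnion_le (d := d) (ι := Fin (m + 1)) 0 1) (fun e z => by
      simp only [Set.mem_ofPred_eq]
      rw [ballUnion_comp_perm])
  rw [volume_inter_norm_le_first, ← ofReal_integral_eq_lintegral_ofReal hint
    (ae_of_all _ fun y => by have := hW y; positivity)] at hvol
  rw [smallUnionVolume, measureReal_def, hvol, ENNReal.toReal_mul, ENNReal.toReal_natCast,
    ENNReal.toReal_ofReal (integral_nonneg fun y => by have := hW y; positivity), hval]
  have := Nat.factorial_pos (m + 1)
  push_cast
  field_simp

end

/-! ### Moments and conditional law of the cell mass. -/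

section

variable {d : ℕ}

/-- No index is below `0`, so the tie-breaking clause is vacuous. -/
theorem voronoiCell_cons_zero {n : ℕ} (x : EuclideanSpace ℝ (Fin d))
    (p : Fin n → EuclideanSpace ℝ (Fin d)) :
    voronoiCell (Fin.cons x p : Fin (n + 1) → EuclideanSpace ℝ (Fin d)) 0 =
      {w | ∀ j, dist w x ≤ dist w (p j)} := by
  ext w
  simp [voronoiCell, Fin.forall_fin_succ, dist_eq_norm]

/-- `n + 1` times the mass of the cell of `x` among `x, p 0, …, p (n - 1)`. -/
noncomputable def scaledCellMassAt (μ : Measure (EuclideanSpace ℝ (Fin d))) (n : ℕ)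
    (x : EuclideanSpace ℝ (Fin d)) (p : Fin n → EuclideanSpace ℝ (Fin d)) : ℝ :=
  scaledFirstCellMass μ (n + 1) (Fin.cons x p)

theorem scaledCellMassAt_eq (μ : Measure (EuclideanSpace ℝ (Fin d))) (n : ℕ)
    (x : EuclideanSpace ℝ (Fin d)) (p : Fin n → EuclideanSpace ℝ (Fin d)) :
    scaledCellMassAt μ n x p = (n + 1 : ℝ) * μ.real {w | ∀ j, dist w x ≤ dist w (p j)} := by
  rw [scaledCellMassAt, scaledFirstCellMass, voronoiCell_cons_zero]
  push_cast
  rfl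

theorem scaledCellMassAt_nonneg (μ : Measure (EuclideanSpace ℝ (Fin d)))
    (n : ℕ) (x : EuclideanSpace ℝ (Fin d))
    (p : Fin n → EuclideanSpace ℝ (Fin d)) : 0 ≤ scaledCellMassAt μ n x p := by
  rw [scaledCellMassAt_eq]
  positivity

variable (μ : Measure (EuclideanSpace ℝ (Fin d))) [IsProbabilityMeasure μ]

theorem measurable_scaledCellMassAt_prod (n : ℕ) :
    Measurable fun q : EuclideanSpace ℝ (Fin d) × (Fin n → EuclideanSpace ℝ (Fin d)) =>
      scaledCellMassAt μ n q.1 q.2 :=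
  (measurable_scaledFirstCellMass μ (n + 1)).comp (measurable_fst.finCons measurable_snd)

theorem measurable_scaledCellMassAt (n : ℕ) (x : EuclideanSpace ℝ (Fin d)) :
    Measurable (scaledCellMassAt μ n x) :=
  (measurable_scaledFirstCellMass μ (n + 1)).comp (measurable_const.finCons measurable_id)

theorem scaledCellMassAt_le (n : ℕ) (x : EuclideanSpace ℝ (Fin d))
    (p : Fin n → EuclideanSpace ℝ (Fin d)) : scaledCellMassAt μ n x p ≤ n + 1 := by
  rw [scaledCellMassAt_eq]
  exact mul_le_of_le_one_right (by positivity) measureReal_le_one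

/-- The moments of the cell mass of `x` in terms of the mass of ball unions. -/
theorem integral_scaledCellMassAt_pow (n k : ℕ) (x : EuclideanSpace ℝ (Fin d)) :
    ∫ p, scaledCellMassAt μ n x p ^ k ∂(Measure.pi fun _ : Fin n => μ) =
      (n + 1 : ℝ) ^ k * ∫ z, (1 - μ.real (ballUnion x z)) ^ n ∂(Measure.pi fun _ : Fin k => μ) := by
  -- The section of `D` at `p` is the `k`-th power of the cell of `x`; its section at `z` is the
  -- `n`-th power of the complement of the ball union. Fubini equates the two integrals.
  set D : Set ((Fin n → EuclideanSpace ℝ (Fin d)) × (Fin k → EuclideanSpace ℝ (Fin d))) :=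
    {q | ∀ i j, dist (q.2 i) x ≤ dist (q.2 i) (q.1 j)} with hD
  have hDm : MeasurableSet D := by
    simp only [hD, Set.ofPred_forall]
    exact MeasurableSet.iInter fun i => MeasurableSet.iInter fun j =>
      measurableSet_le (by fun_prop) (by fun_prop)
  have h1 : ∀ p : Fin n → EuclideanSpace ℝ (Fin d), scaledCellMassAt μ n x p ^ k =
      (n + 1 : ℝ) ^ k * ((Measure.pi fun _ : Fin k => μ) (Prod.mk p ⁻¹' D)).toReal := by
    intro p
    have : Prod.mk p ⁻¹' D = Set.univ.pi fun _ : Fin k => {w | ∀ j, dist w x ≤ dist w (p j)} := by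
      ext z; simp [hD, Set.mem_pi]
    rw [this, Measure.pi_pi, Finset.prod_const, Finset.card_univ, Fintype.card_fin,
      ENNReal.toReal_pow, scaledCellMassAt_eq, mul_pow, measureReal_def]
  have h2 : ∀ z : Fin k → EuclideanSpace ℝ (Fin d), (1 - μ.real (ballUnion x z)) ^ n =
      ((Measure.pi fun _ : Fin n => μ) ((fun p => (p, z)) ⁻¹' D)).toReal := by
    intro z
    have : (fun p => (p, z)) ⁻¹' D = Set.univ.pi fun _ : Fin n => (ballUnion x z)ᶜ := by
      ext p
      simp only [hD, Set.mem_preimage, Set.mem_ofPred_eq, Set.mem_pi, Set.mem_univ, true_imp_iff,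
        Set.mem_compl_iff, mem_ballUnion, not_exists, not_lt]
      rw [forall_comm]
      simp only [dist_comm]
    rw [this, Measure.pi_pi, Finset.prod_const, Finset.card_univ, Fintype.card_fin,
      ENNReal.toReal_pow, ← measureReal_def,
      probReal_compl_eq_one_sub (isOpen_ballUnion x z).measurableSet]
  simp_rw [h1, h2]
  rw [integral_const_mul, integral_toReal (measurable_measure_prodMk_left hDm).aemeasurable
    (ae_of_all _ fun _ => measure_lt_top _ _), integral_toReal
    (measurable_measure_prodMk_right hDm).aemeasurable (ae_of_all _ fun _ => measure_lt_top _ _),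
    ← Measure.prod_apply hDm, ← Measure.prod_apply_symm hDm]

/-- The law of the scaled mass of the cell of `x` among `x` and `n` independent random points. -/
noncomputable def cellMassLaw (n : ℕ) (x : EuclideanSpace ℝ (Fin d)) : ProbabilityMeasure ℝ :=
  ⟨(Measure.pi fun _ : Fin n => μ).map (scaledCellMassAt μ n x),
    Measure.isProbabilityMeasure_map (measurable_scaledCellMassAt μ n x).aemeasurable⟩

theorem coe_cellMassLaw (n : ℕ) (x : EuclideanSpace ℝ (Fin d)) :
    (cellMassLaw μ n x : Measure ℝ) =
      (Measure.pi fun _ : Fin n => μ).map (scaledCellMassAt μ n x) := rfl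

theorem limitMoment_le_factorial [NeZero d] (k : ℕ) : limitMoment d k ≤ k ! := by
  calc limitMoment d k ≤ ∫ _ : Fin (k - 1) → EuclideanSpace ℝ (Fin d), (k ! : ℝ)
        ∂(Measure.pi fun _ => uniformUnitBall d) := by
        refine integral_mono (integrable_limitMoment d k) (integrable_const _) fun y => ?_
        exact div_le_self (by positivity) (one_le_pow₀ (one_le_unionVolumeRatio y))
    _ = k ! := by simp

theorem eq_of_hasLimitMoments [NeZero d] {ν ν' : ProbabilityMeasure ℝ}
    (h : HasLimitMoments d ν) (h' : HasLimitMoments d ν') : ν' = ν := by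
  refine Subtype.ext (eq_of_moments_eq_of_le_factorial (ν := (ν : Measure ℝ))
    (ν' := (ν' : Measure ℝ)) (fun k hk => (h k hk).1) (fun k hk => (h' k hk).1)
    (fun k hk => ?_) fun k hk => ?_)
  · rw [(h k hk).2, (h' k hk).2]
  · rw [(h k hk).2]
    exact limitMoment_le_factorial k

/-- The limits of the moments involve neither `x` nor `a`, so neither does the limit law. -/
theorem exists_tendsto_cellMassLaw [NeZero d] {x : EuclideanSpace ℝ (Fin d)} {a : ℝ} (ha : 0 < a)
    (h : HasLocalDensityAt μ x a) :
    ∃ ν : ProbabilityMeasure ℝ, (∀ᵐ z ∂(ν : Measure ℝ), 0 ≤ z) ∧ HasLimitMoments d ν ∧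
      Tendsto (fun n => cellMassLaw μ n x) atTop (𝓝 ν) := by
  refine exists_tendsto_of_moments_tendsto (m := limitMoment d) (fun n => ?_) (fun n k => ?_)
    (fun k hk => ?_) fun k _ => limitMoment_le_factorial k
  · rw [coe_cellMassLaw, ae_map_iff (measurable_scaledCellMassAt μ n x).aemeasurable
      measurableSet_Ici]
    exact ae_of_all _ fun p => scaledCellMassAt_nonneg μ n x p
  · rw [coe_cellMassLaw, integrable_map_measure (by fun_prop)
      (measurable_scaledCellMassAt μ n x).aemeasurable]
    refine Integrable.of_bound ((measurable_scaledCellMassAt μ n x).pow_const k).aestronglyMeasurable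
      ((n + 1 : ℝ) ^ k) (ae_of_all _ fun p => ?_)
    rw [Function.comp, Real.norm_of_nonneg (pow_nonneg (scaledCellMassAt_nonneg μ n x p) k)]
    exact pow_le_pow_left₀ (scaledCellMassAt_nonneg μ n x p) (scaledCellMassAt_le μ n x p) k
  · rw [← smallUnionVolume_mul_factorial hk]
    refine (tendsto_pow_mul_integral_one_sub_pow (Measure.pi fun _ : Fin k => μ)
      (measurable_measureReal_ballUnion μ x) (fun _ => measureReal_nonneg)
      (fun _ => measureReal_le_one) k (h.tendsto_measureReal_div_pow ha k)).congr fun n => ?_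
    rw [coe_cellMassLaw, integral_map (measurable_scaledCellMassAt μ n x).aemeasurable
      (by fun_prop), integral_scaledCellMassAt_pow]

/-- The laws `cellMassLaw μ n x` as a Markov kernel in `x`. -/
noncomputable def cellMassKernel (n : ℕ) : Kernel (EuclideanSpace ℝ (Fin d)) ℝ where
  toFun x := (Measure.pi fun _ : Fin n => μ).map (scaledCellMassAt μ n x)
  measurable' := by
    refine Measure.measurable_of_measurable_coe _ fun s hs => ?_
    simp_rw [Measure.map_apply (measurable_scaledCellMassAt μ n _) hs]
    exact measurable_measure_prodMk_left (measurable_scaledCellMassAt_prod μ n hs)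

instance isMarkovKernel_cellMassKernel (n : ℕ) : IsMarkovKernel (cellMassKernel μ n) :=
  ⟨fun x => Measure.isProbabilityMeasure_map (measurable_scaledCellMassAt μ n x).aemeasurable⟩

variable {Ω : Type*} [MeasurableSpace Ω] {P : Measure Ω} [IsProbabilityMeasure P]
  {X : ℕ → Ω → EuclideanSpace ℝ (Fin d)}

/-- By independence, conditioning on the first point amounts to substituting its value. -/
theorem map_prodMk_scaledFirstCellMass (hX : ∀ i, Measurable (X i)) (hlaw : ∀ i, P.map (X i) = μ)
    (hindep : iIndepFun X P) (n : ℕ) :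
    P.map (fun ω => (X 0 ω, scaledFirstCellMass μ (n + 1) fun j : Fin (n + 1) => X j ω)) =
      P.map (X 0) ⊗ₘ cellMassKernel μ n := by
  have hjoint : P.map (fun ω (j : Fin (n + 1)) => X j ω) = Measure.pi fun _ => μ := by
    have hi : iIndepFun (fun j : Fin (n + 1) => X j) P :=
      hindep.precomp (g := fun j : Fin (n + 1) => (j : ℕ)) Fin.val_injective
    have h := (iIndepFun_iff_map_fun_eq_pi_map (f := fun j : Fin (n + 1) => X j)
      fun j => (hX j).aemeasurable).mp hi
    simpa only [hlaw] using h
  have hg : Measurable fun q : Fin (n + 1) → EuclideanSpace ℝ (Fin d) =>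
      (q 0, scaledFirstCellMass μ (n + 1) q) :=
    (measurable_pi_apply 0).prodMk (measurable_scaledFirstCellMass μ (n + 1))
  have hXm : Measurable fun ω (j : Fin (n + 1)) => X j ω := measurable_pi_iff.mpr fun j => hX j
  have hmp := (measurePreserving_piFinSuccAbove (fun _ : Fin (n + 1) => μ) 0).symm
  have hcomp : P.map (fun ω => (X 0 ω, scaledFirstCellMass μ (n + 1)
      fun j : Fin (n + 1) => X j ω)) = (μ.prod (Measure.pi fun _ : Fin n => μ)).map
        (fun q => (q.1, scaledCellMassAt μ n q.1 q.2)) := by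
    have e1 := Measure.map_map (μ := P) hg hXm
    rw [hjoint, ← hmp.map_eq, Measure.map_map hg (MeasurableEquiv.measurable _)] at e1
    refine Eq.trans ?_ (e1.symm.trans ?_)
    · rfl
    · congr 1
      ext1 q
      simp [MeasurableEquiv.piFinSuccAbove_symm_apply, Fin.insertNthEquiv, scaledCellMassAt]
  have hm : Measurable fun q : EuclideanSpace ℝ (Fin d) × (Fin n → EuclideanSpace ℝ (Fin d)) =>
      (q.1, scaledCellMassAt μ n q.1 q.2) :=
    measurable_fst.prodMk (measurable_scaledCellMassAt_prod μ n)
  rw [hcomp, hlaw]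
  ext s hs
  rw [Measure.map_apply hm hs, Measure.prod_apply (hm hs), Measure.compProd_apply hs]
  refine lintegral_congr fun x => ?_
  change _ = ((Measure.pi fun _ : Fin n => μ).map (scaledCellMassAt μ n x)) _
  rw [Measure.map_apply (measurable_scaledCellMassAt μ n x) (measurable_prodMk_left hs)]
  rfl

theorem ae_condLawFirstCellMass_eq (hX : ∀ i, Measurable (X i)) (hlaw : ∀ i, P.map (X i) = μ)
    (hindep : iIndepFun X P) (n : ℕ) :
    ∀ᵐ x ∂μ, condLawFirstCellMass P μ X (n + 1) x = cellMassLaw μ n x := by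
  have hY : Measurable fun ω => scaledFirstCellMass μ (n + 1) fun j : Fin (n + 1) => X j ω :=
    (measurable_scaledFirstCellMass μ (n + 1)).comp (measurable_pi_iff.mpr fun j => hX j)
  have h := condDistrib_ae_eq_of_measure_eq_compProd_of_measurable (hX 0) hY
    (map_prodMk_scaledFirstCellMass μ hX hlaw hindep n)
  rw [hlaw] at h
  filter_upwards [h] with x hx
  exact Subtype.ext hx

end

theorem theorem2 (d : ℕ) [NeZero d] :
    ∃ ν : ProbabilityMeasure ℝ,
      (∀ᵐ z ∂(ν : Measure ℝ), 0 ≤ z) ∧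
      HasLimitMoments d ν ∧
      (∀ ν' : ProbabilityMeasure ℝ, HasLimitMoments d ν' → ν' = ν) ∧
      ∀ (μ : Measure (EuclideanSpace ℝ (Fin d))) [IsProbabilityMeasure μ], μ ≪ volume →
        ∀ (Ω : Type*) [MeasurableSpace Ω] (P : Measure Ω) [IsProbabilityMeasure P]
          (X : ℕ → Ω → EuclideanSpace ℝ (Fin d)),
          (∀ i, Measurable (X i)) → (∀ i, P.map (X i) = μ) → iIndepFun X P →
          ∀ᵐ x ∂μ,
            Tendsto (fun n : ℕ => condLawFirstCellMass P μ X (n + 1) x) atTop (𝓝 ν) := by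
  -- The limit law is produced from one sample distribution; any absolutely continuous probability
  -- measure would serve.
  obtain ⟨x₀, a₀, ha₀, h₀⟩ := (ae_hasLocalDensityAt (μ := uniformUnitBall d)
    cond_absolutelyContinuous).exists
  obtain ⟨ν, hpos, hν, -⟩ := exists_tendsto_cellMassLaw (uniformUnitBall d) ha₀ h₀
  refine ⟨ν, hpos, hν, fun ν' hν' => eq_of_hasLimitMoments hν hν', ?_⟩
  intro μ _ hμ Ω _ P _ X hX hlaw hindep
  filter_upwards [ae_hasLocalDensityAt hμ,
    ae_all_iff.mpr (ae_condLawFirstCellMass_eq μ hX hlaw hindep)] with x ⟨a, ha, hx⟩ heq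
  obtain ⟨ν', -, hν', hlim⟩ := exists_tendsto_cellMassLaw μ ha hx
  -- The limit at `x` has the same moments as `ν`, hence equals it.
  rw [eq_of_hasLimitMoments hν hν'] at hlim
  exact hlim.congr fun n => (heq n).symm
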